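/- Identify $\mathbb{R}^4$ with $\mathbb{R}^2(x)\times\mathbb{R}^2(y)$, with its standard inner product, and let $J=\begin{pmatrix}0&\mathbb{1}\\-\mathbb{1}&0\end{pmatrix}$. For a compact convex set $C\subset\mathbb{R}^4$ with the origin in its interior let $\mu_C(z)=\min\{t\ge 0: z\in tC\}$ be its Minkowski functional and $\partial\mu_C$ the subdifferential of $\mu_C$. A closed characteristic on $\partial C$ is an absolutely continuous loop $x:\mathbb{R}/\mathbb{Z}\to\mathbb{R}^4$ with $\mu_C(x(t))=1$ for all $t$ and $\dot x(t)\in (0,\infty)\,J\,\partial\mu_C(x(t))$ for almost every $t$; its action is $\mathbb{A}(x)=-\frac12\int_{\mathbb{R}/\mathbb{Z}}\langle J\dot x(t),x(t)\rangle\,dt$. The EHZ-capacity of $C$ is $$c_{EHZ}(C)=\min\{\mathbb{A}(x): x\text{ a closed characteristic on }\partial C\}.$$ For a compact convex set with nonempty interior that does not contain the origin in its interior, the capacity is that of any translate that does. A trapezoid is the closed region bounded by a nondegenerate convex quadrilateral with at least one pair of parallel sides (parallelograms included); nondegenerate triangles are included as degenerate trapezoids. Theorem. Let $Q\subset\mathbb{R}^2$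 be any trapezoid and $T\subset\mathbb{R}^2$ any convex body (compact convex set with nonempty interior). Then, for every translate of $Q\times T$ with the origin in its interior, the minimum defining its EHZ-capacity is attained, and $$\mathrm{vol}(Q\times T)\ \ge\ \frac{c_{EHZ}(Q\times T)^2}{2},$$ where $c_{EHZ}(Q\times T)$ is the capacity of any such translate. -/

import Mathlib

open Set MeasureTheory

/-- The Euclidean plane. -/
abbrev Plane : Type := EuclideanSpace ℝ (Fin 2)

/-- The phase space `ℝ⁴ = ℝ²(x) × ℝ²(y)`, with the product Lebesgue measure. -/
abbrev PhaseSpace : Type := Plane × Plane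

/-- The standard inner product of `ℝ⁴` (the instance norm on a product is the sup norm, so it is
written out). -/
noncomputable def phaseInner (z w : PhaseSpace) : ℝ :=
  inner ℝ z.1 w.1 + inner ℝ z.2 w.2

/-- The symplectic matrix with block rows `(0, 1)` and `(-1, 0)`: `J (x, y) = (y, -x)`. -/
def sympJ (z : PhaseSpace) : PhaseSpace := (z.2, -z.1)

/-- The subdifferential at `z` of a real-valued function on `ℝ⁴`. -/
def subdifferential (f : PhaseSpace → ℝ) (z : PhaseSpace) : Set PhaseSpace :=
  {w | ∀ y, f z + phaseInner w (y - z) ≤ f y}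

/-- Closed characteristics on the boundary of `C`, where `C` is a compact convex set with the
origin in its interior; `gauge C` is the Minkowski functional of `C`. The circle `ℝ/ℤ` is
represented by `[0, 1]` with its end points identified. The factor `r` is strictly positive, so
that constant loops are not closed characteristics. -/
structure IsClosedCharacteristic (C : Set PhaseSpace) (x : ℝ → PhaseSpace) : Prop where
  absolutelyContinuous : AbsolutelyContinuousOnInterval x 0 1
  closed : x 0 = x 1
  gauge_eq_one : ∀ t ∈ Icc (0 : ℝ) 1, gauge C (x t) = 1
  velocity : ∀ᵐ t ∂(volume.restrict (Icc (0 : ℝ) 1)),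
    ∃ r : ℝ, 0 < r ∧ ∃ w ∈ subdifferential (gauge C) (x t), HasDerivAt x (r • sympJ w) t

/-- The action `-(1/2) ∫ ⟨J ẋ(t), x(t)⟩ dt` of a loop. -/
noncomputable def loopAction (x : ℝ → PhaseSpace) : ℝ :=
  -(1 / 2) * ∫ t in (0 : ℝ)..1, phaseInner (sympJ (deriv x t)) (x t)

/-- The set of actions of the closed characteristics on the boundary of `C`. -/
def actionSpectrum (C : Set PhaseSpace) : Set ℝ :=
  {a | ∃ x : ℝ → PhaseSpace, IsClosedCharacteristic C x ∧ loopAction x = a}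

/-- The EHZ-capacity of `C`: the minimal action of a closed characteristic on the boundary.
That the infimum is a minimum is to be asserted by `IsLeast (actionSpectrum C) (cEHZ C)`. -/
noncomputable def cEHZ (C : Set PhaseSpace) : ℝ := sInf (actionSpectrum C)

/-- Convex bodies of the plane. -/
structure IsConvexBody (T : Set Plane) : Prop where
  isCompact : IsCompact T
  convex : Convex ℝ T
  interior_nonempty : (interior T).Nonempty

/-- (Solid) trapezoids `a b c d`: the side from `d` to `c` is parallel to the side from `a` to `b`,
and `a`, `b`, `d` are not collinear. Parallelograms (`r = 1`) are included, and so are triangles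
(`r = 0`, that is, `c = d`). -/
def IsTrapezoid (Q : Set Plane) : Prop :=
  ∃ a b c d : Plane, AffineIndependent ℝ ![a, b, d] ∧
    (∃ r : ℝ, 0 ≤ r ∧ c - d = r • (b - a)) ∧ Q = convexHull ℝ {a, b, c, d}


/-!
In an affine frame the trapezoid is `Q = {0 ≤ f' ≤ 1, 0 ≤ e', e' + k f' ≤ 1}` with `0 ≤ k ≤ 1`.
Its outer normals form three closed triples: `(f', -f', 0)` and the two cyclic orders of
`e' + k f'`, `-e'`, `-k f'`. Let `c` be the largest number such that `T` contains, for each of the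
three triples, a closed triangle whose edges are `c` times the normals. Then `c` is the capacity.

*Lower bound.* The action `A` of a closed characteristic `(q, p)` is the length of `q` measured by
the support function of `T`, so it bounds the lengths of the triangles inscribed in `q`. Evaluating
these lengths on the three triangles in `T` shows that a translate of `q` lies in `(A / c) Q`. Since
the velocity of `p` is an inner normal of `Q` at `q`, integrating `q` against it shows that `q` has
no translate in a smaller copy of `Q`. Hence `A ≥ c`.

*Attainment.* For the triple that limits `c`, a hyperplane supporting the set of triangles in `T`
at the extremal one is given by a dual triangle `q`, whose edges are normals of `T` at the vertices
`p`. It satisfies the same length bound, so a translate of it lies in `Q`, and its normalization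
forces its vertices onto the sides with the prescribed normals. Together `q` and `p` form a
polygonal closed characteristic of action `c`.

*Volume.* In the coordinates dual to the frame, `T` contains a vertical chord of length `c` and two
opposite triangles of width `c` with a vertical side `c k`. Convexity gives its area at least
`c² / (2 - k)`, while `Q` has area `(2 - k) / 2` in the frame.
-/
/-! ### Areas of convex sets of `ℝ × ℝ` by vertical chords -/

/-- The plane set `S` contains the end points of a vertical segment of length `l` over `x`. For
`l = 0` this says that `x` lies in the projection of `S` to the first coordinate. -/
def HasChord (S : Set (ℝ × ℝ)) (x l : ℝ) : Prop := ∃ y, (x, y) ∈ S ∧ (x, y + l) ∈ S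

section Chords

variable {S : Set (ℝ × ℝ)} {c k α β x₀ x l : ℝ}

lemma convex_setOf_hasChord (hS : Convex ℝ S) : Convex ℝ {z : ℝ × ℝ | HasChord S z.1 z.2} := by
  rintro ⟨x₁, l₁⟩ ⟨y₁, hlow₁, hup₁⟩ ⟨x₂, l₂⟩ ⟨y₂, hlow₂, hup₂⟩ s t hs ht hst
  refine ⟨s * y₁ + t * y₂, by simpa using hS hlow₁ hlow₂ hs ht hst, ?_⟩
  convert hS hup₁ hup₂ hs ht hst using 1
  ext
  · simp
  · simp only [Prod.smul_mk, smul_eq_mul, Prod.mk_add_mk]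
    ring

lemma HasChord.mono (hS : Convex ℝ S) {l' : ℝ} (h : HasChord S x l) (h₀ : 0 ≤ l') (hl : l' ≤ l) :
    HasChord S x l' := by
  have hzero : HasChord S x 0 := h.imp fun y hy => ⟨hy.1, by simpa using hy.1⟩
  have hconv : Convex ℝ {l | HasChord S x l} :=
    Convex.affine_preimage ((AffineMap.const ℝ ℝ x).prod (AffineMap.id ℝ ℝ))
      (convex_setOf_hasChord hS)
  exact hconv.ordConnected.out hzero h ⟨h₀, hl⟩

lemma ordConnected_setOf_hasChord_zero (hS : Convex ℝ S) : OrdConnected {x | HasChord S x 0} :=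
  (Convex.affine_preimage ((AffineMap.id ℝ ℝ).prod (AffineMap.const ℝ ℝ (0 : ℝ)))
    (convex_setOf_hasChord hS)).ordConnected

lemma HasChord.ofReal_le_volume_section (hS : Convex ℝ S) (h : HasChord S x l) :
    ENNReal.ofReal l ≤ volume (Prod.mk x ⁻¹' S) := by
  obtain ⟨y, hlow, hup⟩ := h
  have hconv : Convex ℝ (Prod.mk x ⁻¹' S) :=
    hS.affine_preimage ((AffineMap.const ℝ ℝ x).prod (AffineMap.id ℝ ℝ))
  calc ENNReal.ofReal l = volume (Icc y (y + l)) := by rw [Real.volume_Icc, add_sub_cancel_left]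
    _ ≤ volume (Prod.mk x ⁻¹' S) := measure_mono (hconv.ordConnected.out hlow hup)

lemma integral_affine_interpolation {x₁ x₂ : ℝ} (hx : x₁ < x₂) (l₁ l₂ : ℝ) :
    ∫ x in x₁..x₂, (l₁ + (x - x₁) / (x₂ - x₁) * (l₂ - l₁)) = (x₂ - x₁) * (l₁ + l₂) / 2 := by
  have hne : x₂ - x₁ ≠ 0 := (sub_pos.2 hx).ne'
  rw [intervalIntegral.integral_add (Continuous.intervalIntegrable (by fun_prop) _ _)
    (Continuous.intervalIntegrable (by fun_prop) _ _), intervalIntegral.integral_mul_const,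
    intervalIntegral.integral_div,
    intervalIntegral.integral_comp_sub_right (fun x => x), intervalIntegral.integral_const,
    integral_id, smul_eq_mul]
  field_simp
  ring

lemma HasChord.trapezoid_le_volume_strip (hS : Convex ℝ S) (hm : MeasurableSet S)
    {x₁ x₂ l₁ l₂ : ℝ} (hx : x₁ ≤ x₂) (hl₁ : 0 ≤ l₁) (hl₂ : 0 ≤ l₂)
    (h₁ : HasChord S x₁ l₁) (h₂ : HasChord S x₂ l₂) :
    ENNReal.ofReal ((x₂ - x₁) * (l₁ + l₂) / 2) ≤ volume (S ∩ Ioc x₁ x₂ ×ˢ univ) := by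
  rcases hx.eq_or_lt with rfl | hlt
  · simp
  have hpos : 0 < x₂ - x₁ := sub_pos.2 hlt
  set ℓ : ℝ → ℝ := fun x => l₁ + (x - x₁) / (x₂ - x₁) * (l₂ - l₁) with hℓ
  have hmem : ∀ x ∈ Ioc x₁ x₂, (x - x₁) / (x₂ - x₁) ∈ Icc (0 : ℝ) 1 := fun x hx =>
    ⟨div_nonneg (by linarith [hx.1]) hpos.le, (div_le_one hpos).2 (by linarith [hx.2])⟩
  have hchord : ∀ x ∈ Ioc x₁ x₂, HasChord S x (ℓ x) := fun x hx => by
    simpa [hℓ, div_mul_cancel₀ _ hpos.ne'] using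
      (convex_setOf_hasChord hS).add_smul_sub_mem (x := (x₁, l₁)) (y := (x₂, l₂)) h₁ h₂ (hmem x hx)
  have hnonneg : ∀ x ∈ Ioc x₁ x₂, 0 ≤ ℓ x := fun x hx => by
    have := hmem x hx
    nlinarith [mul_nonneg this.1 hl₂, mul_nonneg (sub_nonneg.2 this.2) hl₁]
  have hcont : Continuous ℓ := by fun_prop
  calc ENNReal.ofReal ((x₂ - x₁) * (l₁ + l₂) / 2)
      = ENNReal.ofReal (∫ x in Ioc x₁ x₂, ℓ x) := by
        rw [← intervalIntegral.integral_of_le hx, integral_affine_interpolation hlt]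
    _ = ∫⁻ x in Ioc x₁ x₂, ENNReal.ofReal (ℓ x) :=
        ofReal_integral_eq_lintegral_ofReal hcont.integrableOn_Ioc
          (ae_restrict_of_forall_mem measurableSet_Ioc hnonneg)
    _ ≤ ∫⁻ x in Ioc x₁ x₂, volume (Prod.mk x ⁻¹' S) :=
        setLIntegral_mono' measurableSet_Ioc fun x hx =>
          (hchord x hx).ofReal_le_volume_section hS
    _ = volume (S ∩ Ioc x₁ x₂ ×ˢ univ) := by
        rw [← Measure.restrict_apply hm, Measure.volume_eq_prod, ← Measure.prod_restrict,
          Measure.restrict_univ, Measure.prod_apply hm]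

lemma volume_real_strip_add (hS : IsCompact S) {x₁ x₂ x₃ : ℝ} (h₁₂ : x₁ ≤ x₂) (h₂₃ : x₂ ≤ x₃) :
    volume.real (S ∩ Ioc x₁ x₂ ×ˢ univ) + volume.real (S ∩ Ioc x₂ x₃ ×ˢ univ) =
      volume.real (S ∩ Ioc x₁ x₃ ×ˢ univ) := by
  have hfin : ∀ u v : ℝ, volume (S ∩ Ioc u v ×ˢ univ) ≠ ⊤ := fun u v =>
    measure_ne_top_of_subset inter_subset_left hS.measure_ne_top
  rw [← Ioc_union_Ioc_eq_Ioc h₁₂ h₂₃, union_prod, inter_union_distrib_left,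
    measureReal_union _ _ (hfin _ _) (hfin _ _)]
  · exact Disjoint.mono inter_subset_right inter_subset_right
      (Disjoint.set_prod_left (Ioc_disjoint_Ioc_of_le le_rfl) _ _)
  · exact hS.measurableSet.inter (measurableSet_Ioc.prod MeasurableSet.univ)

lemma sum_trapezoids_le_volume_strip (hS : Convex ℝ S) (hc : IsCompact S) {n : ℕ}
    {x l : Fin (n + 1) → ℝ} (hx : Monotone x) (hl : ∀ i, 0 ≤ l i)
    (h : ∀ i, HasChord S (x i) (l i)) :
    ∑ i : Fin n, (x i.succ - x i.castSucc) * (l i.castSucc + l i.succ) / 2 ≤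
      volume.real (S ∩ Ioc (x 0) (x (Fin.last n)) ×ˢ univ) := by
  induction n with
  | zero => simp
  | succ n ih =>
    rw [Fin.sum_univ_castSucc, ← Fin.succ_last, ← volume_real_strip_add hc
      (hx (Fin.zero_le (Fin.last n).castSucc)) (hx (Fin.castSucc_le_succ (Fin.last n)))]
    refine add_le_add ?_ ?_
    · exact ih (x := x ∘ Fin.castSucc) (l := l ∘ Fin.castSucc)
        (hx.comp Fin.strictMono_castSucc.monotone) (fun i => hl _) fun i => h _
    · exact (ENNReal.ofReal_le_iff_le_toReal
        (measure_ne_top_of_subset inter_subset_left hc.measure_ne_top)).1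
        ((h _).trapezoid_le_volume_strip hS hc.measurableSet (hx (Fin.castSucc_le_succ _))
          (hl _) (hl _) (h _))

lemma sum_trapezoids_le_volume (hS : Convex ℝ S) (hc : IsCompact S) {n : ℕ}
    {x l : Fin (n + 1) → ℝ} (hx : Monotone x) (hl : ∀ i, 0 ≤ l i)
    (h : ∀ i, HasChord S (x i) (l i)) :
    ∑ i : Fin n, (x i.succ - x i.castSucc) * (l i.castSucc + l i.succ) / 2 ≤ volume.real S :=
  (sum_trapezoids_le_volume_strip hS hc hx hl h).trans
    (measureReal_mono inter_subset_left hc.measure_ne_top)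

lemma two_trapezoids_le_volume (hS : Convex ℝ S) (hc : IsCompact S) {x₁ x₂ x₃ l₁ l₂ l₃ : ℝ}
    (h₁₂ : x₁ ≤ x₂) (h₂₃ : x₂ ≤ x₃) (hl₁ : 0 ≤ l₁) (hl₂ : 0 ≤ l₂) (hl₃ : 0 ≤ l₃)
    (h₁ : HasChord S x₁ l₁) (h₂ : HasChord S x₂ l₂) (h₃ : HasChord S x₃ l₃) :
    (x₂ - x₁) * (l₁ + l₂) / 2 + (x₃ - x₂) * (l₂ + l₃) / 2 ≤ volume.real S := by
  simpa [Fin.sum_univ_succ] using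
    sum_trapezoids_le_volume hS hc (x := ![x₁, x₂, x₃]) (l := ![l₁, l₂, l₃])
      (by simp [Fin.monotone_iff_le_succ, Fin.forall_fin_two, h₁₂, h₂₃])
      (by simp [Fin.forall_fin_succ, hl₁, hl₂, hl₃]) (by simp [Fin.forall_fin_succ, h₁, h₂, h₃])

lemma sq_div_le_volume_of_chords_ordered (hS : Convex ℝ S) (hcpt : IsCompact S) (hc : 0 ≤ c)
    (hk : 0 ≤ k) (hk1 : k ≤ 1) (hα : HasChord S α (c * k)) (hαc : HasChord S (α + c) 0)
    (hβ : HasChord S β 0) (hβc : HasChord S (β + c) (c * k)) (h₀ : HasChord S x₀ c)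
    (hαx : α ≤ x₀) (hxβ : x₀ ≤ β + c) :
    c ^ 2 / (2 - k) ≤ volume.real S := by
  have hck : 0 ≤ c * k := mul_nonneg hc hk
  have h2k : 0 < 2 - k := by linarith
  rw [div_le_iff₀ h2k]
  rcases le_total β α with hβα | hαβ
  · have triangle : c * (α + c - β) / 2 ≤ volume.real S := by
      linarith [two_trapezoids_le_volume hS hcpt (hβα.trans hαx)
        (hxβ.trans (add_le_add_left hβα c)) le_rfl hc le_rfl hβ h₀ hαc]
    have pentagon : (c ^ 2 * (1 + k) - (α - β) * c * (1 - k)) / 2 ≤ volume.real S :=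
      (le_of_eq (by
        simp only [Fin.sum_univ_succ, Fin.sum_univ_zero, Fin.castSucc_zero, Fin.castSucc_succ,
          Matrix.cons_val_zero, Matrix.cons_val_succ]
        ring)).trans <|
        sum_trapezoids_le_volume hS hcpt (x := ![β, α, x₀, β + c, α + c])
          (l := ![0, c * k, c, c * k, 0])
          (by simp [Fin.monotone_iff_le_succ, Fin.forall_fin_succ, hβα, hαx, hxβ])
          (by simp [Fin.forall_fin_succ, hc, hck])
          (by simp [Fin.forall_fin_succ, hβ, hα, h₀, hβc, hαc])
    linarith [mul_le_mul_of_nonneg_left triangle (sub_nonneg.2 hk1)]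
  · have quadrilateral : (β + c - α) * (c * k + c) / 2 ≤ volume.real S := by
      linarith [two_trapezoids_le_volume hS hcpt hαx hxβ hck hc hck hα h₀ hβc]
    have hvol : c ^ 2 * (1 + k) ≤ 2 * volume.real S := by
      linarith [mul_nonneg (add_nonneg hck hc) (sub_nonneg.2 hαβ)]
    linarith [mul_le_mul_of_nonneg_right hvol h2k.le,
      mul_nonneg (sq_nonneg c) (mul_nonneg hk (sub_nonneg.2 hk1))]

lemma sq_div_le_volume_of_chords (hS : Convex ℝ S) (hcpt : IsCompact S) (hc : 0 ≤ c)
    (hk : 0 ≤ k) (hk1 : k ≤ 1) (hα : HasChord S α (c * k)) (hαc : HasChord S (α + c) 0)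
    (hβ : HasChord S β 0) (hβc : HasChord S (β + c) (c * k)) (h₀ : HasChord S x₀ c) :
    c ^ 2 / (2 - k) ≤ volume.real S := by
  have hck : c * k ≤ c := mul_le_of_le_one_right hc hk1
  have h₀k : HasChord S x₀ (c * k) := h₀.mono hS (mul_nonneg hc hk) hck
  have h₀₀ : HasChord S x₀ 0 := h₀.mono hS le_rfl hc
  have hconn := ordConnected_setOf_hasChord_zero hS
  obtain ⟨α', hα'x, hα', hα'c⟩ : ∃ α' ≤ x₀, HasChord S α' (c * k) ∧ HasChord S (α' + c) 0 := by
    rcases le_total α x₀ with hαx | hxα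
    · exact ⟨α, hαx, hα, hαc⟩
    · exact ⟨x₀, le_rfl, h₀k, hconn.out h₀₀ hαc ⟨by linarith, by linarith⟩⟩
  obtain ⟨β', hxβ', hβ', hβ'c⟩ :
      ∃ β', x₀ ≤ β' + c ∧ HasChord S β' 0 ∧ HasChord S (β' + c) (c * k) := by
    rcases le_total x₀ (β + c) with hxβ | hβx
    · exact ⟨β, hxβ, hβ, hβc⟩
    · exact ⟨x₀ - c, by simp, hconn.out hβ h₀₀ ⟨by linarith, by linarith⟩, by simpa using h₀k⟩
  exact sq_div_le_volume_of_chords_ordered hS hcpt hc hk hk1 hα' hα'c hβ' hβ'c h₀ hα'x hxβ'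

end Chords

/-! ### Polygons in a convex body and their dual polygons -/

/-- The outer normal cone at `y` of a set `S`: the vectors whose inner product over `S` is largest
at `y` (where `y` itself is not required to lie in `S`). -/
def normalCone {E : Type*} [NormedAddCommGroup E] [InnerProductSpace ℝ E] (S : Set E) (y : E) :
    Set E :=
  {v | ∀ z ∈ S, inner ℝ v z ≤ inner ℝ v y}

/-- The set `T` contains the vertices of a closed polygon whose edges, traversed backwards, are the
vectors `c • d j`. -/
def HasPolygon {E : Type*} [AddCommGroup E] [Module ℝ E] {n : ℕ} [NeZero n] (T : Set E) (c : ℝ)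
    (d : Fin n → E) : Prop :=
  ∃ p : Fin n → E, (∀ j, p j ∈ T) ∧ ∀ j, p (j - 1) - p j = c • d j

/-- The polygon `q` is dual to the polygon `p` in `T` with edges `s • d`: the edges of `q` are outer
normals of `T` at the vertices of `p`. The normalization of `q` makes its length, measured by
the support function of `T`, equal to `s`. -/
structure IsDualPolygon {E : Type*} [NormedAddCommGroup E] [InnerProductSpace ℝ E] {n : ℕ}
    [NeZero n] (T : Set E) (s : ℝ) (d p q : Fin n → E) : Prop where
  mem : ∀ j, p j ∈ T
  edge : ∀ j, p (j - 1) - p j = s • d j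
  normal : ∀ j, q (j + 1) - q j ∈ normalCone T (p j)
  sum_inner : ∑ j, inner ℝ (d j) (q j) = 1

lemma exists_support_on_ray {E : Type*} [NormedAddCommGroup E] [NormedSpace ℝ E] {K : Set E}
    (hK : IsCompact K) (hconv : Convex ℝ K) (h0 : K ∈ nhds (0 : E)) {D : E} (hD : D ≠ 0) :
    ∃ s : ℝ, 0 < s ∧ s • D ∈ K ∧ ∃ f : E →L[ℝ] ℝ, f D = 1 ∧ ∀ x ∈ K, f x ≤ s := by
  have hgauge : 0 < gauge K D :=
    (gauge_pos (absorbent_nhds_zero h0) (NormedSpace.isVonNBounded_iff ℝ |>.2 hK.isBounded)).2 hD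
  set s : ℝ := (gauge K D)⁻¹
  have hs : 0 < s := inv_pos.2 hgauge
  have hone : gauge K (s • D) = 1 := by
    rw [gauge_smul_of_nonneg hs.le, smul_eq_mul, inv_mul_cancel₀ hgauge.ne']
  have hmem : s • D ∈ K := by
    simpa [hK.isClosed.closure_eq] using (gauge_le_one_iff_mem_closure hconv h0).1 hone.le
  have hnot : s • D ∉ interior K := fun h =>
    ((gauge_lt_one_iff_mem_interior hconv h0).2 h).ne hone
  obtain ⟨f, hf⟩ := geometric_hahn_banach_open_point hconv.interior isOpen_interior hnot
  have hfD : 0 < f D := by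
    have := hf 0 (mem_interior_iff_mem_nhds.2 h0)
    rw [map_zero, map_smul, smul_eq_mul] at this
    exact pos_of_mul_pos_right this hs.le
  have hsub : K ⊆ {x | f x ≤ f (s • D)} := calc
    K ⊆ closure (interior K) := by
      rw [hconv.closure_interior_eq_closure_of_nonempty_interior
        ⟨0, mem_interior_iff_mem_nhds.2 h0⟩]
      exact subset_closure
    _ ⊆ {x | f x ≤ f (s • D)} :=
      closure_minimal (fun y hy => (hf y hy).le) (isClosed_le f.continuous continuous_const)
  refine ⟨s, hs, hmem, (f D)⁻¹ • f, by simp [hfD.ne'], fun x hx => ?_⟩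
  have hx' : f x ≤ s * f D := by simpa using hsub hx
  rwa [smul_apply, smul_eq_mul, inv_mul_le_iff₀ hfD, mul_comm]

section Cyclic

variable {n : ℕ} [NeZero n] {E : Type*} [AddCommGroup E] [Module ℝ E]
  {T : Set E} {c s : ℝ} {d : Fin n → E}

lemma sum_cyclic_shift {M : Type*} [AddCommMonoid M] (g : Fin n → M) (r : Fin n) :
    ∑ j, g (j + r) = ∑ j, g j :=
  Equiv.sum_comp (Equiv.addRight r) g

lemma exists_cyclic_sub_eq {G : Type*} [AddCommGroup G] {d : Fin n → G} (hd : ∑ j, d j = 0) :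
    ∃ p : Fin n → G, ∀ j, p (j - 1) - p j = d j := by
  refine ⟨fun j => -∑ i ∈ Finset.Iic j, d i, fun j => ?_⟩
  have hpred : ∑ i ∈ Finset.Iic (j - 1), d i = ∑ i ∈ Finset.Iio j, d i := by
    rcases eq_or_ne j 0 with rfl | hj
    · obtain ⟨m, rfl⟩ := Nat.exists_eq_succ_of_ne_zero (NeZero.ne n)
      have hlast : (0 : Fin (m + 1)) - 1 = Fin.last m :=
        sub_eq_of_eq_add (Fin.last_add_one m).symm
      have htop : Finset.Iic (Fin.last m) = Finset.univ :=
        Finset.eq_univ_iff_forall.2 fun i => Finset.mem_Iic.2 (Fin.le_last i)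
      have hbot : Finset.Iio (0 : Fin (m + 1)) = ∅ := by ext i; simp
      rw [hlast, htop, hd, hbot, Finset.sum_empty]
    · rw [Fin.Iic_sub_one_eq_Iio (Fin.pos_iff_ne_zero.2 hj)]
  rw [neg_sub_neg, hpred, ← Finset.Iio_insert, Finset.sum_insert (by simp), add_sub_cancel_right]

lemma exists_cyclic_sub_add_eq (g : Fin n → E) :
    ∃ (p : Fin n → E) (t : E), ∀ j, p (j - 1) - p j + t = g j := by
  obtain ⟨p, hp⟩ := exists_cyclic_sub_eq (d := fun j => g j - (n : ℝ)⁻¹ • ∑ i, g i) (by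
    rw [Finset.sum_sub_distrib, Finset.sum_const, Finset.card_univ, Fintype.card_fin,
      ← Nat.cast_smul_eq_nsmul ℝ, smul_inv_smul₀ (NeZero.ne _), sub_self])
  exact ⟨p, (n : ℝ)⁻¹ • ∑ i, g i, fun j => by rw [hp, sub_add_cancel]⟩

lemma HasPolygon.mono (hT : Convex ℝ T) (h : HasPolygon T s d) (hc : 0 < c) (hcs : c ≤ s) :
    HasPolygon T c d := by
  obtain ⟨p, hp, hpd⟩ := h
  have hs : 0 < s := hc.trans_le hcs
  refine ⟨fun j => p 0 + (c / s) • (p j - p 0), fun j =>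
    hT.add_smul_sub_mem (hp 0) (hp j) ⟨by positivity, (div_le_one hs).2 hcs⟩, fun j => ?_⟩
  rw [add_sub_add_left_eq_sub, ← smul_sub, sub_sub_sub_cancel_right, hpd, smul_smul,
    div_mul_cancel₀ _ hs.ne']

lemma HasPolygon.rotate (h : HasPolygon T c d) (r : Fin n) :
    HasPolygon T c fun j => d (j + r) := by
  obtain ⟨p, hp, hpd⟩ := h
  exact ⟨fun j => p (j + r), fun j => hp _, fun j => by
    simp only [← hpd, sub_add_eq_add_sub]⟩

end Cyclic

section ShiftedEdges

/-- The edge vectors of a closed polygon, shifted by a common vector. The shift makes this map to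
the space of all `n`-tuples of vectors surjective. -/
noncomputable def shiftedEdges (E : Type*) [NormedAddCommGroup E] [NormedSpace ℝ E] (n : ℕ)
    [NeZero n] : (Fin n → E) × E →L[ℝ] Fin n → E :=
  ContinuousLinearMap.pi fun j =>
    (ContinuousLinearMap.proj (R := ℝ) (φ := fun _ => E) (j - 1) - ContinuousLinearMap.proj j).comp
      (ContinuousLinearMap.fst ℝ (Fin n → E) E) + ContinuousLinearMap.snd ℝ (Fin n → E) E

variable {E : Type*} [NormedAddCommGroup E] [NormedSpace ℝ E] {n : ℕ} [NeZero n]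

lemma shiftedEdges_apply (p : Fin n → E) (t : E) (j : Fin n) :
    shiftedEdges E n (p, t) j = p (j - 1) - p j + t :=
  rfl

lemma sum_shiftedEdges (p : Fin n → E) (t : E) :
    ∑ j, shiftedEdges E n (p, t) j = (n : ℝ) • t := by
  simp only [shiftedEdges_apply, Finset.sum_add_distrib, Finset.sum_sub_distrib]
  rw [← sum_cyclic_shift (fun j => p (j - 1)) 1]
  simp [Nat.cast_smul_eq_nsmul]

lemma image_shiftedEdges_mem_nhds [CompleteSpace E] {T : Set E}
    (hT : (interior T).Nonempty) :
    shiftedEdges E n '' ((univ.pi fun _ => T) ×ˢ Metric.closedBall 0 1) ∈ nhds 0 := by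
  obtain ⟨t, ht⟩ := hT
  have hnhds : (univ.pi fun _ : Fin n => T) ×ˢ Metric.closedBall (0 : E) 1 ∈
      nhds ((fun _ => t : Fin n → E), (0 : E)) :=
    prod_mem_nhds (set_pi_mem_nhds finite_univ fun _ _ => mem_interior_iff_mem_nhds.1 ht)
      (Metric.closedBall_mem_nhds 0 one_pos)
  have hsurj : Function.Surjective (shiftedEdges E n) := fun g => by
    obtain ⟨p, t, h⟩ := exists_cyclic_sub_add_eq g
    exact ⟨(p, t), funext h⟩
  have hzero : shiftedEdges E n ((fun _ => t : Fin n → E), (0 : E)) = 0 := by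
    ext1 j
    simp [shiftedEdges_apply]
  exact hzero ▸ ((shiftedEdges E n).isOpenMap hsurj).image_mem_nhds hnhds

end ShiftedEdges

section Polygon

variable {E : Type*} [NormedAddCommGroup E] [InnerProductSpace ℝ E] {n : ℕ} [NeZero n]
  {T : Set E} {s : ℝ} {d p q : Fin n → E}

lemma IsDualPolygon.hasPolygon (h : IsDualPolygon T s d p q) : HasPolygon T s d :=
  ⟨p, h.mem, h.edge⟩

lemma sum_inner_cyclic_sub (u w : Fin n → E) :
    ∑ j, inner ℝ (u (j + 1) - u j) (w j) = ∑ j, inner ℝ (w (j - 1) - w j) (u j) := by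
  have hshift : ∑ j, inner ℝ (u (j + 1)) (w j) = ∑ j, inner ℝ (w (j - 1)) (u j) := by
    rw [← sum_cyclic_shift (fun j => inner ℝ (w (j - 1)) (u j)) 1]
    exact Finset.sum_congr rfl fun j _ => by rw [add_sub_cancel_right, real_inner_comm]
  have hcomm : ∑ j, inner ℝ (u j) (w j) = ∑ j, inner ℝ (w j) (u j) :=
    Finset.sum_congr rfl fun j _ => real_inner_comm _ _
  simp only [inner_sub_left, Finset.sum_sub_distrib, hshift, hcomm]

lemma IsDualPolygon.sum_inner_edges (h : IsDualPolygon T s d p q) :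
    ∑ j, inner ℝ (q (j + 1) - q j) (p j) = s := by
  simp only [sum_inner_cyclic_sub, h.edge, real_inner_smul_left, ← Finset.mul_sum, h.sum_inner,
    mul_one]

lemma mem_normalCone_of_sum_inner_le {ι : Type*} [Fintype ι] {v p : ι → E} (hp : ∀ j, p j ∈ T)
    (h : ∀ p' : ι → E, (∀ j, p' j ∈ T) → ∑ j, inner ℝ (v j) (p' j) ≤ ∑ j, inner ℝ (v j) (p j))
    (j : ι) : v j ∈ normalCone T (p j) := by
  classical
  intro y hy
  by_contra! hlt
  refine (h (Function.update p j y) fun i => ?_).not_gt (Finset.sum_lt_sum (fun i _ => ?_)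
    ⟨j, Finset.mem_univ j, by simpa using hlt⟩)
  all_goals rcases eq_or_ne i j with rfl | hij
  · simpa using hy
  · simpa [hij] using hp i
  · simpa using hlt.le
  · simp [hij]

lemma exists_forall_eq_sum_inner [CompleteSpace E] {ι : Type*} [Fintype ι]
    (f : (ι → E) →L[ℝ] ℝ) : ∃ q : ι → E, ∀ g, f g = ∑ j, inner ℝ (q j) (g j) := by
  classical
  refine ⟨fun j => (InnerProductSpace.toDual ℝ E).symm
    (f.comp (ContinuousLinearMap.single ℝ (fun _ => E) j)), fun g => ?_⟩
  simp only [InnerProductSpace.toDual_symm_apply, ContinuousLinearMap.comp_apply, ← map_sum]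
  exact congrArg f (Finset.univ_sum_single g).symm

lemma exists_isDualPolygon [FiniteDimensional ℝ E] (hT : IsCompact T) (hconv : Convex ℝ T)
    (hint : (interior T).Nonempty) (hsum : ∑ j, d j = 0) (hd : d ≠ 0) :
    ∃ s, 0 < s ∧ ∃ p q, IsDualPolygon T s d p q := by
  have hK : IsCompact (shiftedEdges E n '' ((univ.pi fun _ => T) ×ˢ Metric.closedBall 0 1)) :=
    ((isCompact_univ_pi fun _ => hT).prod (isCompact_closedBall 0 1)).image
      (shiftedEdges E n).continuous
  have hKconv : Convex ℝ (shiftedEdges E n '' ((univ.pi fun _ => T) ×ˢ Metric.closedBall 0 1)) :=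
    ((convex_pi fun _ _ => hconv).prod (convex_closedBall 0 1)).linear_image
      (shiftedEdges E n).toLinearMap
  obtain ⟨s, hs, ⟨⟨p, t⟩, ⟨hp, -⟩, hpd⟩, f, hfd, hf⟩ :=
    exists_support_on_ray hK hKconv (image_shiftedEdges_mem_nhds hint) hd
  obtain ⟨q, hq⟩ := exists_forall_eq_sum_inner f
  have ht : t = 0 := by
    have : (n : ℝ) • t = 0 := by
      rw [← sum_shiftedEdges p t, hpd]
      simp [← Finset.smul_sum, hsum]
    exact (smul_eq_zero_iff_right (NeZero.ne _)).1 this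
  have hlen : ∀ p' : Fin n → E,
      f (shiftedEdges E n (p', 0)) = ∑ j, inner ℝ (q (j + 1) - q j) (p' j) := fun p' => by
    rw [sum_inner_cyclic_sub, hq]
    exact Finset.sum_congr rfl fun j _ => by
      rw [shiftedEdges_apply, add_zero, real_inner_comm]
  subst ht
  refine ⟨s, hs, p, q, fun j => hp j (mem_univ j), fun j => ?_,
    mem_normalCone_of_sum_inner_le (fun j => hp j (mem_univ j)) fun p' hp' => ?_, ?_⟩
  · simpa [shiftedEdges_apply] using congrFun hpd j
  · rw [← hlen, ← hlen, hpd, map_smul, hfd, smul_eq_mul, mul_one]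
    exact hf _ ⟨(p', 0), ⟨fun j _ => hp' j, Metric.mem_closedBall_self zero_le_one⟩, rfl⟩
  · simp only [real_inner_comm (q _), ← hq, hfd]

end Polygon

/-! ### Lengths of inscribed polygons -/

/-- The number `A` bounds from above the lengths, measured by the support function of `T`, of the
closed `n`-gons inscribed in the cyclically ordered family of points `q`. -/
def BoundsInscribed {E ι : Type*} [NormedAddCommGroup E] [InnerProductSpace ℝ E] [Preorder ι]
    (n : ℕ) [NeZero n] (T : Set E) (q : ι → E) (A : ℝ) : Prop :=
  ∀ p : Fin n → E, (∀ j, p j ∈ T) → ∀ i : Fin n → ι, Monotone i →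
    ∑ j, inner ℝ (q (i (j + 1)) - q (i j)) (p j) ≤ A

lemma sum_succ_sub_castSucc {G : Type*} [AddCommGroup G] {n : ℕ} (g : Fin (n + 1) → G) :
    ∑ j : Fin n, (g j.succ - g j.castSucc) = g (Fin.last n) - g 0 := by
  rw [Finset.sum_sub_distrib, sub_eq_sub_iff_add_eq_add, add_comm, ← Fin.sum_univ_succ,
    Fin.sum_univ_castSucc, add_comm]

lemma snoc_zero_succ {α : Type*} {n : ℕ} [NeZero n] (g : Fin n → α) (j : Fin n) :
    (Fin.snoc g (g 0) : Fin (n + 1) → α) j.succ = g (j + 1) := by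
  obtain ⟨m, rfl⟩ := Nat.exists_eq_succ_of_ne_zero (NeZero.ne n)
  cases j using Fin.lastCases with
  | last => rw [Fin.succ_last, Fin.snoc_last, Fin.last_add_one]
  | cast j => rw [Fin.succ_castSucc, Fin.snoc_castSucc, Fin.coeSucc_eq_succ]

section BoundsInscribed

variable {E ι : Type*} [NormedAddCommGroup E] [InnerProductSpace ℝ E] [Preorder ι]
  {n : ℕ} [NeZero n] {T : Set E} {q : ι → E} {A c : ℝ}

lemma boundsInscribed_of_monotone [BoundedOrder ι] (hq : q ⊥ = q ⊤) {G : ι → ℝ}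
    (hG : ∀ y ∈ T, Monotone fun a => G a - inner ℝ (q a) y) :
    BoundsInscribed n T q (G ⊤ - G ⊥) := by
  have hincr : ∀ y ∈ T, ∀ a b, a ≤ b → inner ℝ (q b - q a) y ≤ G b - G a := fun y hy a b hab => by
    have := hG y hy hab
    rw [inner_sub_left]
    linarith
  intro p hp i hi
  obtain ⟨m, rfl⟩ := Nat.exists_eq_succ_of_ne_zero (NeZero.ne n)
  have hinner : ∑ j : Fin m, inner ℝ (q (i j.succ) - q (i j.castSucc)) (p j.castSucc) ≤
      G (i (Fin.last m)) - G (i 0) :=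
    (Finset.sum_le_sum fun j _ => hincr _ (hp _) _ _ (hi j.castSucc_le_succ)).trans_eq
      (sum_succ_sub_castSucc fun j => G (i j))
  have hwrap : inner ℝ (q (i 0) - q (i (Fin.last m))) (p (Fin.last m)) ≤
      (G (i 0) - G ⊥) + (G ⊤ - G (i (Fin.last m))) := by
    rw [← sub_add_sub_cancel (q (i 0)) (q ⊥), inner_add_left, hq]
    exact add_le_add (hq ▸ hincr _ (hp _) _ _ bot_le) (hincr _ (hp _) _ _ le_top)
  simp only [Fin.sum_univ_castSucc, Fin.coeSucc_eq_succ, Fin.last_add_one]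
  linarith

lemma BoundsInscribed.comp {κ : Type*} [Preorder κ] (h : BoundsInscribed n T q A) {φ : κ → ι}
    (hφ : Monotone φ) : BoundsInscribed n T (fun a => q (φ a)) A :=
  fun p hp i hi => h p hp (fun j => φ (i j)) (hφ.comp hi)

lemma BoundsInscribed.mul_sum_le {d : Fin n → E} (h : BoundsInscribed n T q A)
    (hd : HasPolygon T c d) {i : Fin n → ι} {r : Fin n} (hi : Monotone fun j => i (j + r)) :
    c * ∑ j, inner ℝ (d j) (q (i j)) ≤ A := by
  obtain ⟨p, hp, hpd⟩ := hd.rotate r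
  calc c * ∑ j, inner ℝ (d j) (q (i j))
      = ∑ j, inner ℝ (c • d (j + r)) (q (i (j + r))) := by
        rw [sum_cyclic_shift (fun j => inner ℝ (c • d j) (q (i j))), Finset.mul_sum]
        simp only [real_inner_smul_left]
    _ = ∑ j, inner ℝ (q (i (j + 1 + r)) - q (i (j + r))) (p j) := by
        simp only [← hpd, sum_inner_cyclic_sub fun j => q (i (j + r))]
    _ ≤ A := h p hp _ hi

lemma IsDualPolygon.boundsInscribed {m : ℕ} [NeZero m] {s : ℝ} {d p q : Fin m → E}
    (h : IsDualPolygon T s d p q) : BoundsInscribed n T q s := by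
  let q' : Fin (m + 1) → E := Fin.snoc q (q 0)
  let G : Fin (m + 1) → ℝ := Fin.partialSum fun j => inner ℝ (q (j + 1) - q j) (p j)
  have hG : ∀ y ∈ T, Monotone fun a => G a - inner ℝ (q' a) y := fun y hy => by
    refine Fin.monotone_iff_le_succ.2 fun j => ?_
    have hnormal := h.normal j y hy
    simp only [G, Fin.partialSum_succ, q', snoc_zero_succ, Fin.snoc_castSucc]
    rw [inner_sub_left] at hnormal
    linarith
  have hclosed : q' ⊥ = q' ⊤ :=
    (Fin.snoc_castSucc (α := fun _ => E) (q 0) q 0).trans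
      (Fin.snoc_last (α := fun _ => E) (q 0) q).symm
  have hlength : G ⊤ - G ⊥ = s := calc
    G ⊤ - G ⊥ = ∑ j : Fin m, (G j.succ - G j.castSucc) := (sum_succ_sub_castSucc G).symm
    _ = s := by simp only [G, Fin.partialSum_succ, add_sub_cancel_left, h.sum_inner_edges]
  have hbound :=
    (boundsInscribed_of_monotone (n := n) hclosed hG).comp Fin.strictMono_castSucc.monotone
  simpa only [hlength, q', Fin.snoc_castSucc] using hbound

lemma exists_monotone_rotation {ι : Type*} [LinearOrder ι] (l i j : ι) :
    (∃ r : Fin 3, Monotone fun m => ![l, i, j] (m + r)) ∨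
      ∃ r : Fin 3, Monotone fun m => ![l, j, i] (m + r) := by
  simp only [Fin.monotone_iff_le_succ, Fin.forall_fin_two, Fin.exists_fin_succ]
  rcases le_total l i with hli | hil <;> rcases le_total l j with hlj | hjl <;>
    rcases le_total i j with hij | hji <;> simp [*]

end BoundsInscribed

/-! ### Absolutely continuous curves -/

section Curves

lemma absolutelyContinuousOnInterval_clm_comp {E F : Type*} [NormedAddCommGroup E]
    [NormedSpace ℝ E] [NormedAddCommGroup F] [NormedSpace ℝ F] {f : ℝ → E} {a b : ℝ}
    (hf : AbsolutelyContinuousOnInterval f a b) (L : E →L[ℝ] F) :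
    AbsolutelyContinuousOnInterval (fun t => L (f t)) a b := by
  refine squeeze_zero (fun t => Finset.sum_nonneg fun _ _ => dist_nonneg) (fun t => ?_)
    (by simpa using Filter.Tendsto.const_mul ‖L‖ hf)
  rw [Finset.mul_sum]
  exact Finset.sum_le_sum fun i _ => L.lipschitz.dist_le_mul _ _

lemma intervalIntegral_pos_of_ae_pos {f : ℝ → ℝ} {a b : ℝ} (hab : a < b)
    (hf : IntervalIntegrable f volume a b) (hpos : ∀ᵐ t, t ∈ Ioc a b → 0 < f t) :
    0 < ∫ t in a..b, f t := by
  rw [intervalIntegral.integral_pos_iff_support_of_nonneg_ae' _ hf]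
  · have hsupport : Ioc a b ≤ᵐ[volume] (Function.support f ∩ Ioc a b : Set ℝ) := by
      filter_upwards [hpos] with t ht hmem using ⟨(ht hmem).ne', hmem⟩
    exact ⟨hab, (by simpa using hab : 0 < volume (Ioc a b)).trans_le (measure_mono_ae hsupport)⟩
  · rw [uIoc_of_le hab.le, Filter.EventuallyLE, ae_restrict_iff' measurableSet_Ioc]
    filter_upwards [hpos] with t ht hmem using (ht hmem).le

variable {E : Type*} [NormedAddCommGroup E] [InnerProductSpace ℝ E] [FiniteDimensional ℝ E]
  {q p : ℝ → E} {a b : ℝ}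

lemma ae_differentiableAt_of_absolutelyContinuous (hq : AbsolutelyContinuousOnInterval q a b) :
    ∀ᵐ t, t ∈ uIcc a b → DifferentiableAt ℝ q t := by
  let v := stdOrthonormalBasis ℝ E
  have hcoord : ∀ᵐ t, ∀ i, t ∈ uIcc a b → DifferentiableAt ℝ (fun s => inner ℝ (v i) (q s)) t :=
    ae_all_iff.2 fun i =>
      (absolutelyContinuousOnInterval_clm_comp hq (innerSL ℝ (v i))).ae_differentiableAt
  have hsum : q = fun s => ∑ i, inner ℝ (v i) (q s) • v i := funext fun s => (v.sum_repr' _).symm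
  filter_upwards [hcoord] with t ht hmem
  rw [hsum]
  exact DifferentiableAt.fun_sum fun i _ => (ht i hmem).smul_const (v i)

lemma intervalIntegrable_inner_deriv (hq : AbsolutelyContinuousOnInterval q a b)
    (hp : ContinuousOn p (uIcc a b)) :
    IntervalIntegrable (fun t => inner ℝ (deriv q t) (p t)) volume a b := by
  let v := stdOrthonormalBasis ℝ E
  have hcoord : ∀ i ∈ Finset.univ, IntervalIntegrable
      (fun t => deriv (fun s => inner ℝ (v i) (q s)) t * inner ℝ (v i) (p t)) volume a b :=
    fun i _ => (absolutelyContinuousOnInterval_clm_comp hq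
      (innerSL ℝ (v i))).intervalIntegrable_deriv.mul_continuousOn (by fun_prop)
  refine (IntervalIntegrable.sum _ hcoord).congr_ae ?_
  rw [Filter.EventuallyEq, ae_restrict_iff' measurableSet_uIoc]
  filter_upwards [ae_differentiableAt_of_absolutelyContinuous hq] with t ht hmem
  have hderiv : ∀ i, deriv (fun s => inner ℝ (v i) (q s)) t = inner ℝ (deriv q t) (v i) :=
    fun i => by
      rw [real_inner_comm]
      exact ((innerSL ℝ (v i)).hasFDerivAt.comp_hasDerivAt t
        (ht (uIoc_subset_uIcc hmem)).hasDerivAt).deriv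
  simp only [Finset.sum_apply, hderiv, v.sum_inner_mul_inner]

lemma absolutelyContinuousOnInterval_inner (hq : AbsolutelyContinuousOnInterval q a b)
    (hp : AbsolutelyContinuousOnInterval p a b) :
    AbsolutelyContinuousOnInterval (fun t => inner ℝ (q t) (p t)) a b := by
  let v := stdOrthonormalBasis ℝ E
  have hsum : (fun t => inner ℝ (q t) (p t)) =
      ∑ i, fun t => inner ℝ (v i) (q t) * inner ℝ (v i) (p t) := by
    ext t
    simp only [Finset.sum_apply, real_inner_comm (q t) (v _), v.sum_inner_mul_inner]
  rw [hsum]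
  refine Finset.sum_induction _ (AbsolutelyContinuousOnInterval · a b) (fun _ _ => .add)
    ((LipschitzWith.const 0).lipschitzOnWith.absolutelyContinuousOnInterval) fun i _ => ?_
  exact (absolutelyContinuousOnInterval_clm_comp hq (innerSL ℝ (v i))).mul
    (absolutelyContinuousOnInterval_clm_comp hp (innerSL ℝ (v i)))

lemma integral_inner_deriv_add_integral_inner_deriv (hq : AbsolutelyContinuousOnInterval q a b)
    (hp : AbsolutelyContinuousOnInterval p a b) :
    (∫ t in a..b, inner ℝ (deriv q t) (p t)) + ∫ t in a..b, inner ℝ (deriv p t) (q t) =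
      inner ℝ (q b) (p b) - inner ℝ (q a) (p a) := by
  rw [← (absolutelyContinuousOnInterval_inner hq hp).integral_deriv_eq_sub,
    ← intervalIntegral.integral_add (intervalIntegrable_inner_deriv hq hp.continuousOn)
      (intervalIntegrable_inner_deriv hp hq.continuousOn)]
  refine intervalIntegral.integral_congr_ae ?_
  filter_upwards [ae_differentiableAt_of_absolutelyContinuous hq,
    ae_differentiableAt_of_absolutelyContinuous hp] with t hqt hpt hmem
  have hmem' := uIoc_subset_uIcc hmem
  rw [((hqt hmem').hasDerivAt.inner ℝ (hpt hmem').hasDerivAt).deriv, add_comm,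
    real_inner_comm (q t)]

lemma integral_inner_deriv_const (hq : AbsolutelyContinuousOnInterval q a b) (v : E) :
    ∫ t in a..b, inner ℝ (deriv q t) v = inner ℝ (q b - q a) v := by
  have hconst : AbsolutelyContinuousOnInterval (fun _ : ℝ => v) a b :=
    (LipschitzWith.const v).lipschitzOnWith.absolutelyContinuousOnInterval
  simpa [inner_sub_left] using integral_inner_deriv_add_integral_inner_deriv hq hconst

end Curves

/-! ### Closed characteristics of products -/

/-- A closed billiard trajectory `q` in the table `A` with momenta `p` in `B`: the velocity of `q`
is an outer normal of `B` at `p`, and that of `p` an inner normal of `A` at `q`. Its length is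
`∫ ⟪q', p⟫`. -/
structure IsBilliardTrajectory {E : Type*} [NormedAddCommGroup E] [InnerProductSpace ℝ E]
    (A B : Set E) (q p : ℝ → E) : Prop where
  absolutelyContinuous_fst : AbsolutelyContinuousOnInterval q 0 1
  absolutelyContinuous_snd : AbsolutelyContinuousOnInterval p 0 1
  closed_fst : q 0 = q 1
  closed_snd : p 0 = p 1
  velocity_fst : ∀ᵐ t, t ∈ Icc (0 : ℝ) 1 → deriv q t ∈ normalCone B (p t)
  velocity_snd : ∀ᵐ t, t ∈ Icc (0 : ℝ) 1 → -deriv p t ∈ normalCone A (q t)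

namespace IsBilliardTrajectory

variable {E : Type*} [NormedAddCommGroup E] [InnerProductSpace ℝ E] [FiniteDimensional ℝ E]
  {A B : Set E} {q p : ℝ → E}

lemma inner_sub_le_integral (h : IsBilliardTrajectory A B q p) {a b : ℝ} (ha : 0 ≤ a)
    (hab : a ≤ b) (hb : b ≤ 1) {y : E} (hy : y ∈ B) :
    inner ℝ (q b - q a) y ≤ ∫ t in a..b, inner ℝ (deriv q t) (p t) := by
  have hsub : uIcc a b ⊆ uIcc (0 : ℝ) 1 := by
    rw [uIcc_of_le hab, uIcc_of_le zero_le_one]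
    exact Icc_subset_Icc ha hb
  have hq := h.absolutelyContinuous_fst.mono hsub
  rw [← integral_inner_deriv_const hq]
  refine intervalIntegral.integral_mono_ae_restrict hab
    (intervalIntegrable_inner_deriv hq continuousOn_const)
    (intervalIntegrable_inner_deriv hq (h.absolutelyContinuous_snd.continuousOn.mono hsub)) ?_
  rw [Filter.EventuallyLE, ae_restrict_iff' measurableSet_Icc]
  filter_upwards [h.velocity_fst] with t ht hmem
  exact ht ⟨ha.trans hmem.1, hmem.2.trans hb⟩ y hy

lemma boundsInscribed (h : IsBilliardTrajectory A B q p) (n : ℕ) [NeZero n] :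
    BoundsInscribed n B (fun t : Icc (0 : ℝ) 1 => q t)
      (∫ t in (0 : ℝ)..1, inner ℝ (deriv q t) (p t)) := by
  let G : Icc (0 : ℝ) 1 → ℝ := fun b => ∫ t in (0 : ℝ)..b, inner ℝ (deriv q t) (p t)
  have hint : ∀ b : Icc (0 : ℝ) 1,
      IntervalIntegrable (fun t => inner ℝ (deriv q t) (p t)) volume 0 b := fun b =>
    (intervalIntegrable_inner_deriv h.absolutelyContinuous_fst
      h.absolutelyContinuous_snd.continuousOn).mono_set (by
        rw [uIcc_of_le b.2.1, uIcc_of_le zero_le_one]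
        exact Icc_subset_Icc_right b.2.2)
  have hG : ∀ y ∈ B, Monotone fun b => G b - inner ℝ (q b) y := fun y hy a b hab => by
    have hle := h.inner_sub_le_integral a.2.1 hab b.2.2 hy
    rw [← intervalIntegral.integral_interval_sub_left (hint b) (hint a), inner_sub_left] at hle
    simp only [G]
    linarith
  simpa [G] using boundsInscribed_of_monotone (n := n) h.closed_fst hG

lemma integral_inner_snd (h : IsBilliardTrajectory A B q p) :
    ∫ t in (0 : ℝ)..1, inner ℝ (deriv p t) (q t) =
      -∫ t in (0 : ℝ)..1, inner ℝ (deriv q t) (p t) := by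
  have hparts := integral_inner_deriv_add_integral_inner_deriv h.absolutelyContinuous_fst
    h.absolutelyContinuous_snd
  rw [h.closed_fst, h.closed_snd, sub_self] at hparts
  linarith

lemma one_le_of_translate_mem_smul (h : IsBilliardTrajectory A B q p)
    (hpos : 0 < ∫ t in (0 : ℝ)..1, inner ℝ (deriv q t) (p t)) {W : ℝ} (hW : 0 ≤ W) {v : E}
    (hv : ∀ t ∈ Icc (0 : ℝ) 1, ∃ y ∈ A, q t + v = W • y) : 1 ≤ W := by
  have hp := h.absolutelyContinuous_snd
  have hint := intervalIntegrable_inner_deriv hp h.absolutelyContinuous_fst.continuousOn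
  have hint_v := intervalIntegrable_inner_deriv (p := fun _ => v) hp continuousOn_const
  have hzero : ∫ t in (0 : ℝ)..1, inner ℝ (deriv p t) v = 0 := by
    rw [integral_inner_deriv_const hp, h.closed_snd, sub_self, inner_zero_left]
  have hle : ∫ t in (0 : ℝ)..1, W * inner ℝ (deriv p t) (q t) ≤
      ∫ t in (0 : ℝ)..1, (inner ℝ (deriv p t) (q t) + inner ℝ (deriv p t) v) := by
    refine intervalIntegral.integral_mono_ae_restrict zero_le_one (hint.const_mul W)
      (hint.add hint_v) ?_
    rw [Filter.EventuallyLE, ae_restrict_iff' measurableSet_Icc]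
    filter_upwards [h.velocity_snd] with t ht hmem
    obtain ⟨y, hy, hyv⟩ := hv t hmem
    have hnormal := ht hmem y hy
    rw [inner_neg_left, inner_neg_left, neg_le_neg_iff] at hnormal
    rw [← inner_add_right, hyv, inner_smul_right]
    exact mul_le_mul_of_nonneg_left hnormal hW
  rw [intervalIntegral.integral_add hint hint_v, hzero, intervalIntegral.integral_const_mul,
    h.integral_inner_snd] at hle
  exact le_of_mul_le_mul_right (by linarith) hpos

end IsBilliardTrajectory

section Subdifferential

variable {C : Set PhaseSpace} {z w y : PhaseSpace}

lemma phaseInner_sympJ_left (v z : PhaseSpace) :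
    phaseInner (sympJ v) z = inner ℝ v.2 z.1 - inner ℝ v.1 z.2 := by
  simp only [phaseInner, sympJ, inner_neg_left, sub_eq_add_neg]

lemma phaseInner_self_of_mem_subdifferential (hw : w ∈ subdifferential (gauge C) z) :
    phaseInner w z = gauge C z := by
  have h0 := hw 0
  have h2 := hw ((2 : ℝ) • z)
  rw [gauge_smul_of_nonneg zero_le_two] at h2
  simp only [phaseInner, gauge_zero, smul_eq_mul, Prod.fst_sub, Prod.snd_sub, Prod.fst_zero,
    Prod.snd_zero, Prod.smul_fst, Prod.smul_snd, inner_sub_right, inner_smul_right,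
    inner_zero_right] at *
  linarith

lemma phaseInner_sympJ_smul_sympJ (hw : w ∈ subdifferential (gauge C) z) (r : ℝ) :
    phaseInner (sympJ (r • sympJ w)) z = -(r * gauge C z) := by
  rw [← phaseInner_self_of_mem_subdifferential hw]
  simp only [phaseInner, sympJ, Prod.smul_mk, inner_neg_left, smul_neg, real_inner_smul_left]
  ring

lemma phaseInner_le_of_mem_subdifferential (hw : w ∈ subdifferential (gauge C) z)
    (hz : gauge C z = 1) (hy : y ∈ C) : phaseInner w y ≤ phaseInner w z := by
  have hsub := hw y
  have hgauge := gauge_le_one_of_mem hy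
  simp only [phaseInner, Prod.fst_sub, Prod.snd_sub, inner_sub_right] at *
  linarith

lemma phaseInner_le_gauge (hC : C ∈ nhds (0 : PhaseSpace)) (hw : ∀ y ∈ C, phaseInner w y ≤ 1)
    (y : PhaseSpace) : phaseInner w y ≤ gauge C y := by
  refine le_csInf (absorbent_nhds_zero hC).gauge_set_nonempty ?_
  rintro r ⟨hr, u, hu, rfl⟩
  have := mul_le_mul_of_nonneg_left (hw u hu) (le_of_lt hr)
  simp only [phaseInner, Prod.smul_fst, Prod.smul_snd, inner_smul_right] at *
  linarith

lemma gauge_eq_one_and_mem_subdifferential (hC : C ∈ nhds (0 : PhaseSpace))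
    (hw : ∀ y ∈ C, phaseInner w y ≤ 1) (hz : z ∈ C) (hwz : phaseInner w z = 1) :
    gauge C z = 1 ∧ w ∈ subdifferential (gauge C) z := by
  have hgauge : gauge C z = 1 :=
    le_antisymm (gauge_le_one_of_mem hz) (hwz ▸ phaseInner_le_gauge hC hw z)
  refine ⟨hgauge, fun y => ?_⟩
  have := phaseInner_le_gauge hC hw y
  simp only [phaseInner, Prod.fst_sub, Prod.snd_sub, inner_sub_right] at *
  linarith

end Subdifferential

namespace IsClosedCharacteristic

variable {A B : Set Plane} {C : Set PhaseSpace} {x : ℝ → PhaseSpace}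

lemma absolutelyContinuous_fst (hx : IsClosedCharacteristic C x) :
    AbsolutelyContinuousOnInterval (fun t => (x t).1) 0 1 :=
  absolutelyContinuousOnInterval_clm_comp hx.absolutelyContinuous (ContinuousLinearMap.fst ..)

lemma absolutelyContinuous_snd (hx : IsClosedCharacteristic C x) :
    AbsolutelyContinuousOnInterval (fun t => (x t).2) 0 1 :=
  absolutelyContinuousOnInterval_clm_comp hx.absolutelyContinuous (ContinuousLinearMap.snd ..)

lemma ae_deriv_eq (hx : IsClosedCharacteristic C x) :
    ∀ᵐ t, t ∈ Icc (0 : ℝ) 1 → ∃ r : ℝ, 0 < r ∧ ∃ w ∈ subdifferential (gauge C) (x t),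
      deriv x t = r • sympJ w ∧ deriv (fun s => (x s).1) t = r • w.2 ∧
        deriv (fun s => (x s).2) t = -(r • w.1) := by
  filter_upwards [(ae_restrict_iff' measurableSet_Icc).1 hx.velocity] with t ht hmem
  obtain ⟨r, hr, w, hw, hderiv⟩ := ht hmem
  have hfst : HasDerivAt (fun s => (x s).1) (r • w.2) t :=
    (ContinuousLinearMap.fst ℝ Plane Plane).hasFDerivAt.comp_hasDerivAt t hderiv
  have hsnd : HasDerivAt (fun s => (x s).2) (-(r • w.1)) t := by
    rw [← smul_neg]
    exact (ContinuousLinearMap.snd ℝ Plane Plane).hasFDerivAt.comp_hasDerivAt t hderiv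
  exact ⟨r, hr, w, hw, hderiv.deriv, hfst.deriv, hsnd.deriv⟩

lemma isBilliardTrajectory (hx : IsClosedCharacteristic (A ×ˢ B) x) (hA : IsClosed A)
    (hB : IsClosed B) (hA0 : A ∈ nhds (0 : Plane)) (hB0 : B ∈ nhds (0 : Plane))
    (hA' : Convex ℝ A) (hB' : Convex ℝ B) :
    IsBilliardTrajectory A B (fun t => (x t).1) (fun t => (x t).2) := by
  have hmemC : ∀ t ∈ Icc (0 : ℝ) 1, x t ∈ A ×ˢ B := fun t ht => by
    rw [← (hA.prod hB).closure_eq,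
      ← gauge_le_one_iff_mem_closure (hA'.prod hB') (prod_mem_nhds hA0 hB0)]
    exact (hx.gauge_eq_one t ht).le
  refine ⟨hx.absolutelyContinuous_fst, hx.absolutelyContinuous_snd, congrArg Prod.fst hx.closed,
    congrArg Prod.snd hx.closed, ?_, ?_⟩
  all_goals
    filter_upwards [hx.ae_deriv_eq] with t ht hmem y hy
    obtain ⟨r, hr, w, hw, -, hfst, hsnd⟩ := ht hmem
  · have hle := phaseInner_le_of_mem_subdifferential hw (hx.gauge_eq_one t hmem)
      (show ((x t).1, y) ∈ A ×ˢ B from ⟨(hmemC t hmem).1, hy⟩)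
    simp only [hfst, phaseInner, real_inner_smul_left] at hle ⊢
    exact mul_le_mul_of_nonneg_left (by linarith) hr.le
  · have hle := phaseInner_le_of_mem_subdifferential hw (hx.gauge_eq_one t hmem)
      (show (y, (x t).2) ∈ A ×ˢ B from ⟨hy, (hmemC t hmem).2⟩)
    simp only [hsnd, neg_neg, phaseInner, real_inner_smul_left] at hle ⊢
    exact mul_le_mul_of_nonneg_left (by linarith) hr.le

lemma loopAction_eq_half_integral (hx : IsClosedCharacteristic C x) :
    loopAction x = 1 / 2 * ∫ t in (0 : ℝ)..1,
      (inner ℝ (deriv (fun s => (x s).1) t) (x t).2 -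
        inner ℝ (deriv (fun s => (x s).2) t) (x t).1) := by
  rw [loopAction, neg_mul, ← mul_neg, ← intervalIntegral.integral_neg]
  congr 1
  refine intervalIntegral.integral_congr_ae ?_
  filter_upwards [hx.ae_deriv_eq] with t ht hmem
  rw [uIoc_of_le zero_le_one] at hmem
  obtain ⟨r, -, w, -, hderiv, hfst, hsnd⟩ := ht (Ioc_subset_Icc_self hmem)
  rw [phaseInner_sympJ_left, neg_sub, hderiv, hfst, hsnd, ← smul_neg]
  rfl

lemma intervalIntegrable_inner_fst (hx : IsClosedCharacteristic C x) :
    IntervalIntegrable (fun t => inner ℝ (deriv (fun s => (x s).1) t) (x t).2) volume 0 1 :=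
  intervalIntegrable_inner_deriv hx.absolutelyContinuous_fst
    hx.absolutelyContinuous_snd.continuousOn

lemma intervalIntegrable_inner_snd (hx : IsClosedCharacteristic C x) :
    IntervalIntegrable (fun t => inner ℝ (deriv (fun s => (x s).2) t) (x t).1) volume 0 1 :=
  intervalIntegrable_inner_deriv hx.absolutelyContinuous_snd
    hx.absolutelyContinuous_fst.continuousOn

lemma loopAction_pos (hx : IsClosedCharacteristic C x) : 0 < loopAction x := by
  rw [hx.loopAction_eq_half_integral]
  refine mul_pos one_half_pos (intervalIntegral_pos_of_ae_pos zero_lt_one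
    (hx.intervalIntegrable_inner_fst.sub hx.intervalIntegrable_inner_snd) ?_)
  filter_upwards [hx.ae_deriv_eq] with t ht hmem
  obtain ⟨r, hr, w, hw, -, hfst, hsnd⟩ := ht (Ioc_subset_Icc_self hmem)
  have hself := phaseInner_self_of_mem_subdifferential hw
  rw [hx.gauge_eq_one t (Ioc_subset_Icc_self hmem), phaseInner] at hself
  rw [hfst, hsnd, inner_neg_left, sub_neg_eq_add, real_inner_smul_left, real_inner_smul_left,
    ← mul_add, add_comm, hself, mul_one]
  exact hr

lemma loopAction_eq_integral (hx : IsClosedCharacteristic C x)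
    (h : IsBilliardTrajectory A B (fun t => (x t).1) (fun t => (x t).2)) :
    loopAction x = ∫ t in (0 : ℝ)..1, inner ℝ (deriv (fun s => (x s).1) t) (x t).2 := by
  rw [hx.loopAction_eq_half_integral, intervalIntegral.integral_sub hx.intervalIntegrable_inner_fst
    hx.intervalIntegrable_inner_snd, h.integral_inner_snd]
  ring

end IsClosedCharacteristic

/-! ### Polygonal closed characteristics -/

lemma exists_lipschitzWith_concat {E : Type*} [SeminormedAddCommGroup E] {x y : ℝ → E}
    {K L : NNReal} {ℓ : ℝ} (hx : LipschitzWith K x) (hy : LipschitzWith L y) (hxy : x ℓ = y 0) :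
    ∃ u : ℝ → E, LipschitzWith (K + L) u ∧ (∀ t ≤ ℓ, u t = x t) ∧ ∀ t ≥ ℓ, u t = y (t - ℓ) := by
  refine ⟨fun t => x (min t ℓ) + (y (max (t - ℓ) 0) - y 0), ?_, fun t ht => ?_, fun t ht => ?_⟩
  · have hmin : LipschitzWith 1 fun t : ℝ => min t ℓ := LipschitzWith.id.min_const ℓ
    have hmax : LipschitzWith 1 fun t : ℝ => max (t - ℓ) 0 :=
      LipschitzWith.max_const (LipschitzWith.of_dist_le_mul fun a b => by simp) 0
    simpa using (hx.comp hmin).add ((hy.comp hmax).sub (LipschitzWith.const (y 0)))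
  · simp [min_eq_left ht, max_eq_right (sub_nonpos.2 ht)]
  · simp [min_eq_right ht, max_eq_left (sub_nonneg.2 ht), hxy]

/-- There is a Lipschitz path from `z` to `z'` on the boundary of `C` that follows the
characteristic direction with unit factor for the time `ℓ`. The half-open time interval makes the
constant path admissible for `ℓ = 0`, wherever the point is. -/
def HasCharPath (C : Set PhaseSpace) (ℓ : ℝ) (z z' : PhaseSpace) : Prop :=
  0 ≤ ℓ ∧ ∃ (x : ℝ → PhaseSpace) (K : NNReal), LipschitzWith K x ∧ x 0 = z ∧ x ℓ = z' ∧
    (∀ t ∈ Ico 0 ℓ, gauge C (x t) = 1) ∧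
    ∀ᵐ t, t ∈ Ico 0 ℓ → ∃ w ∈ subdifferential (gauge C) (x t), HasDerivAt x (sympJ w) t

namespace HasCharPath

variable {C : Set PhaseSpace}

lemma refl (C : Set PhaseSpace) (z : PhaseSpace) : HasCharPath C 0 z z :=
  ⟨le_rfl, fun _ => z, 0, LipschitzWith.const z, rfl, rfl, by simp, by simp⟩

lemma trans {ℓ₁ ℓ₂ : ℝ} {z₁ z₂ z₃ : PhaseSpace} (h₁ : HasCharPath C ℓ₁ z₁ z₂)
    (h₂ : HasCharPath C ℓ₂ z₂ z₃) : HasCharPath C (ℓ₁ + ℓ₂) z₁ z₃ := by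
  obtain ⟨hℓ₁, x, K, hK, hx0, hxℓ, hxg, hxd⟩ := h₁
  obtain ⟨hℓ₂, y, L, hL, hy0, hyℓ, hyg, hyd⟩ := h₂
  obtain ⟨u, hu, hul, hur⟩ := exists_lipschitzWith_concat hK hL (hxℓ.trans hy0.symm)
  have hyd' : ∀ᵐ t, t - ℓ₁ ∈ Ico 0 ℓ₂ → ∃ w ∈ subdifferential (gauge C) (y (t - ℓ₁)),
      HasDerivAt y (sympJ w) (t - ℓ₁) :=
    (measurePreserving_sub_right volume ℓ₁).quasiMeasurePreserving.ae hyd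
  refine ⟨add_nonneg hℓ₁ hℓ₂, u, K + L, hu, (hul 0 hℓ₁).trans hx0, ?_, fun t ht => ?_, ?_⟩
  · rw [hur _ (le_add_of_nonneg_right hℓ₂), add_sub_cancel_left, hyℓ]
  · rcases lt_or_ge t ℓ₁ with hlt | hge
    · rw [hul t hlt.le]
      exact hxg t ⟨ht.1, hlt⟩
    · rw [hur t hge]
      exact hyg _ ⟨sub_nonneg.2 hge, sub_lt_iff_lt_add'.2 ht.2⟩
  · filter_upwards [hxd, hyd', Measure.ae_ne volume ℓ₁] with t hxt hyt hne ht
    rcases lt_or_gt_of_ne hne with hlt | hgt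
    · obtain ⟨w, hw, hderiv⟩ := hxt ⟨ht.1, hlt⟩
      refine ⟨w, by rwa [hul t hlt.le], hderiv.congr_of_eventuallyEq ?_⟩
      filter_upwards [Iio_mem_nhds hlt] with s hs using hul s (le_of_lt hs)
    · obtain ⟨w, hw, hderiv⟩ := hyt ⟨(sub_pos.2 hgt).le, sub_lt_iff_lt_add'.2 ht.2⟩
      refine ⟨w, by rwa [hur t hgt.le],
        (hderiv.comp_sub_const t ℓ₁).congr_of_eventuallyEq ?_⟩
      filter_upwards [Ioi_mem_nhds hgt] with s hs using hur s (le_of_lt hs)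

lemma range_sum {z : ℕ → PhaseSpace} {ℓ : ℕ → ℝ}
    (h : ∀ j, HasCharPath C (ℓ j) (z j) (z (j + 1))) (n : ℕ) :
    HasCharPath C (∑ j ∈ Finset.range n, ℓ j) (z 0) (z n) := by
  induction n with
  | zero => exact refl C _
  | succ n ih =>
    rw [Finset.sum_range_succ]
    exact ih.trans (h n)

lemma cyclic_sum {n : ℕ} [NeZero n] {z : Fin n → PhaseSpace} {ℓ : Fin n → ℝ}
    (h : ∀ j, HasCharPath C (ℓ j) (z j) (z (j + 1))) : HasCharPath C (∑ j, ℓ j) (z 0) (z 0) := by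
  have hsucc : ∀ j, Fin.ofNat n (j + 1) = Fin.ofNat n j + 1 := fun j => by
    ext
    simp [Fin.val_add, Fin.ofNat]
  have hpath := range_sum (z := fun j => z (Fin.ofNat n j)) (ℓ := fun j => ℓ (Fin.ofNat n j))
    (fun j => by simpa only [hsucc] using h (Fin.ofNat n j)) n
  have hlast : Fin.ofNat n n = 0 := by
    ext
    simp [Fin.ofNat]
  simpa [Finset.sum_range, hlast] using hpath

lemma segment {ℓ : ℝ} (hC : C ∈ nhds (0 : PhaseSpace)) (hconv : Convex ℝ C) (hℓ : 0 < ℓ)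
    {z z' w : PhaseSpace} (hz : z ∈ C) (hz' : z' ∈ C) (hzz' : z' = z + ℓ • sympJ w)
    (hw : ∀ y ∈ C, phaseInner w y ≤ 1) (hwz : phaseInner w z = 1) : HasCharPath C ℓ z z' := by
  have hboundary : ∀ t ∈ Ico 0 ℓ, gauge C (z + t • sympJ w) = 1 ∧
      w ∈ subdifferential (gauge C) (z + t • sympJ w) := by
    intro t ht
    refine gauge_eq_one_and_mem_subdifferential hC hw ?_ ?_
    · have hseg : z + t • sympJ w = z + (t / ℓ) • (z' - z) := by
        rw [hzz', add_sub_cancel_left, smul_smul, div_mul_cancel₀ _ hℓ.ne']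
      rw [hseg]
      exact hconv.add_smul_sub_mem hz hz' ⟨div_nonneg ht.1 hℓ.le, (div_le_one hℓ).2 ht.2.le⟩
    · simp only [phaseInner, sympJ, Prod.fst_add, Prod.snd_add, Prod.smul_fst, Prod.smul_snd,
        inner_add_right, inner_smul_right, inner_neg_right, real_inner_comm w.1 w.2] at *
      linarith
  refine ⟨hℓ.le, fun t => z + t • sympJ w, ‖sympJ w‖₊, ?_, by simp, hzz'.symm,
    fun t ht => (hboundary t ht).1, .of_forall fun t ht => ⟨w, (hboundary t ht).2, ?_⟩⟩
  · refine LipschitzWith.of_dist_le_mul fun a b => ?_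
    rw [dist_add_left, dist_eq_norm, ← sub_smul, norm_smul, dist_eq_norm, mul_comm, coe_nnnorm]
  · simpa using ((hasDerivAt_id t).smul_const (sympJ w)).const_add z

end HasCharPath

lemma eq_zero_of_mem_normalCone {E : Type*} [NormedAddCommGroup E] [InnerProductSpace ℝ E]
    {S : Set E} (hS : S ∈ nhds (0 : E)) {v y : E} (hv : v ∈ normalCone S y)
    (hy : inner ℝ v y = 0) : v = 0 := by
  have ht : Filter.Tendsto (fun t : ℝ => t • v) (nhdsWithin 0 (Ioi 0)) (nhds 0) := by
    have : Continuous fun t : ℝ => t • v := by fun_prop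
    simpa using (this.tendsto 0).mono_left nhdsWithin_le_nhds
  obtain ⟨t, htS, htpos⟩ := ((ht.eventually_mem hS).and eventually_mem_nhdsWithin).exists
  have hle := hv _ htS
  rw [inner_smul_right, hy] at hle
  exact real_inner_self_nonpos.1 (nonpos_of_mul_nonpos_right hle htpos)

namespace HasCharPath

variable {A B : Set Plane}

lemma fst (hA : A ∈ nhds (0 : Plane)) (hB : B ∈ nhds (0 : Plane)) (hA' : Convex ℝ A)
    (hB' : Convex ℝ B) {q q' p : Plane} (hq : q ∈ A) (hq' : q' ∈ A) (hp : p ∈ B)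
    (h : q' - q ∈ normalCone B p) :
    HasCharPath (A ×ˢ B) (inner ℝ (q' - q) p) (q, p) (q', p) := by
  have hnonneg : 0 ≤ inner ℝ (q' - q) p := by simpa using h 0 (mem_of_mem_nhds hB)
  rcases hnonneg.eq_or_lt with hzero | hpos
  · rw [← hzero, sub_eq_zero.1 (eq_zero_of_mem_normalCone hB h hzero.symm)]
    exact refl _ _
  · refine segment (w := (0, (inner ℝ (q' - q) p)⁻¹ • (q' - q)))
      (prod_mem_nhds hA hB) (hA'.prod hB') hpos ⟨hq, hp⟩ ⟨hq', hp⟩ ?_ ?_ ?_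
    · simp [sympJ, smul_smul, hpos.ne']
    · rintro ⟨y₁, y₂⟩ ⟨-, hy⟩
      simp only [phaseInner, inner_zero_left, zero_add, real_inner_smul_left]
      exact (inv_mul_le_one₀ hpos).2 (h _ hy)
    · simp [phaseInner, real_inner_smul_left, hpos.ne']

lemma snd (hA : A ∈ nhds (0 : Plane)) (hB : B ∈ nhds (0 : Plane)) (hA' : Convex ℝ A)
    (hB' : Convex ℝ B) {q p p' : Plane} (hq : q ∈ A) (hp : p ∈ B) (hp' : p' ∈ B)
    (h : p - p' ∈ normalCone A q) :
    HasCharPath (A ×ˢ B) (inner ℝ (p - p') q) (q, p) (q, p') := by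
  have hnonneg : 0 ≤ inner ℝ (p - p') q := by simpa using h 0 (mem_of_mem_nhds hA)
  rcases hnonneg.eq_or_lt with hzero | hpos
  · rw [← hzero, sub_eq_zero.1 (eq_zero_of_mem_normalCone hA h hzero.symm)]
    exact refl _ _
  · refine segment (w := ((inner ℝ (p - p') q)⁻¹ • (p - p'), 0))
      (prod_mem_nhds hA hB) (hA'.prod hB') hpos ⟨hq, hp⟩ ⟨hq, hp'⟩ ?_ ?_ ?_
    · simp [sympJ, smul_smul, hpos.ne']
    · rintro ⟨y₁, y₂⟩ ⟨hy, -⟩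
      simp only [phaseInner, inner_zero_left, add_zero, real_inner_smul_left]
      exact (inv_mul_le_one₀ hpos).2 (h _ hy)
    · simp [phaseInner, real_inner_smul_left, hpos.ne']

end HasCharPath

lemma loopAction_eq_half {C : Set PhaseSpace} {x : ℝ → PhaseSpace} {r : ℝ}
    (hg : ∀ t ∈ Icc (0 : ℝ) 1, gauge C (x t) = 1)
    (hv : ∀ᵐ t, t ∈ Icc (0 : ℝ) 1 → ∃ w ∈ subdifferential (gauge C) (x t),
      HasDerivAt x (r • sympJ w) t) : loopAction x = r / 2 := by
  have hint : ∫ t in (0 : ℝ)..1, phaseInner (sympJ (deriv x t)) (x t) = ∫ _ in (0 : ℝ)..1, -r := by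
    refine intervalIntegral.integral_congr_ae ?_
    filter_upwards [hv] with t ht hmem
    rw [uIoc_of_le zero_le_one] at hmem
    obtain ⟨w, hw, hderiv⟩ := ht (Ioc_subset_Icc_self hmem)
    rw [hderiv.deriv, phaseInner_sympJ_smul_sympJ hw, hg t (Ioc_subset_Icc_self hmem), mul_one]
  rw [loopAction, hint, intervalIntegral.integral_const, sub_zero, one_smul]
  ring

lemma HasCharPath.mem_actionSpectrum {C : Set PhaseSpace} {ℓ : ℝ} {z : PhaseSpace}
    (h : HasCharPath C ℓ z z) (hℓ : 0 < ℓ) : ℓ / 2 ∈ actionSpectrum C := by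
  obtain ⟨-, x, K, hK, hx0, hxℓ, hxg, hxd⟩ := h
  have hg : ∀ t ∈ Icc (0 : ℝ) 1, gauge C (x (ℓ * t)) = 1 := fun t ht => by
    rcases ht.2.lt_or_eq with hlt | rfl
    · exact hxg _ ⟨mul_nonneg hℓ.le ht.1, mul_lt_of_lt_one_right hℓ hlt⟩
    · rw [mul_one, hxℓ, ← hx0]
      exact hxg 0 (left_mem_Ico.2 hℓ)
  have hscale : Measure.QuasiMeasurePreserving (fun t : ℝ => ℓ * t) volume volume :=
    ⟨measurable_const_mul ℓ, by
      rw [Real.map_volume_mul_left hℓ.ne']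
      exact Measure.smul_absolutelyContinuous⟩
  have hv : ∀ᵐ t, t ∈ Icc (0 : ℝ) 1 → ∃ w ∈ subdifferential (gauge C) (x (ℓ * t)),
      HasDerivAt (fun s => x (ℓ * s)) (ℓ • sympJ w) t := by
    filter_upwards [hscale.ae hxd, Measure.ae_ne volume 1] with t ht hne hmem
    obtain ⟨w, hw, hderiv⟩ := ht ⟨mul_nonneg hℓ.le hmem.1,
      mul_lt_of_lt_one_right hℓ (lt_of_le_of_ne hmem.2 hne)⟩
    exact ⟨w, hw, hderiv.scomp t (by simpa using (hasDerivAt_id t).const_mul ℓ)⟩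
  refine ⟨fun t => x (ℓ * t), ⟨?_, by simp [hx0, hxℓ], hg, ?_⟩, loopAction_eq_half hg hv⟩
  · exact ((hK.comp (lipschitzWith_smul ℓ)).lipschitzOnWith
      (s := uIcc 0 1)).absolutelyContinuousOnInterval
  · rw [ae_restrict_iff' measurableSet_Icc]
    filter_upwards [hv] with t ht hmem using ⟨ℓ, hℓ, ht hmem⟩

lemma mem_actionSpectrum_of_polygons {A B : Set Plane} (hA : A ∈ nhds (0 : Plane))
    (hB : B ∈ nhds (0 : Plane)) (hA' : Convex ℝ A) (hB' : Convex ℝ B) {n : ℕ} [NeZero n]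
    {q p : Fin n → Plane} (hq : ∀ j, q j ∈ A) (hp : ∀ j, p j ∈ B)
    (hqp : ∀ j, q (j + 1) - q j ∈ normalCone B (p j))
    (hpq : ∀ j, p (j - 1) - p j ∈ normalCone A (q j))
    (hpos : 0 < ∑ j, inner ℝ (q (j + 1) - q j) (p j)) :
    ∑ j, inner ℝ (q (j + 1) - q j) (p j) ∈ actionSpectrum (A ×ˢ B) := by
  have hpq' : ∀ j, p j - p (j + 1) ∈ normalCone A (q (j + 1)) := fun j => by
    simpa using hpq (j + 1)
  have hpath : HasCharPath (A ×ˢ B)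
      (∑ j, (inner ℝ (q (j + 1) - q j) (p j) + inner ℝ (p j - p (j + 1)) (q (j + 1))))
      (q 0, p 0) (q 0, p 0) :=
    HasCharPath.cyclic_sum (z := fun j => (q j, p j)) fun j =>
      (HasCharPath.fst hA hB hA' hB' (hq _) (hq _) (hp j) (hqp j)).trans
        (HasCharPath.snd hA hB hA' hB' (hq _) (hp _) (hp _) (hpq' j))
  have hlength : ∑ j, inner ℝ (p j - p (j + 1)) (q (j + 1)) =
      ∑ j, inner ℝ (q (j + 1) - q j) (p j) := by
    rw [sum_inner_cyclic_sub, ← sum_cyclic_shift (fun j => inner ℝ (p (j - 1) - p j) (q j)) 1]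
    simp only [add_sub_cancel_right]
  rw [Finset.sum_add_distrib, hlength, ← two_mul] at hpath
  simpa using hpath.mem_actionSpectrum (mul_pos two_pos hpos)

/-! ### Trapezoids in dual coordinates -/

/-- The determinant of two vectors of the plane. -/
def planeDet (u v : Plane) : ℝ := u 0 * v 1 - u 1 * v 0

lemma volume_real_image_inner_prod (u v : Plane) (S : Set Plane) :
    volume.real ((fun p : Plane => (inner ℝ u p, inner ℝ v p)) '' S) =
      |planeDet u v| * volume.real S := by
  let M : Matrix (Fin 2) (Fin 2) ℝ := !![u 0, u 1; v 0, v 1]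
  have himage : (fun p : Plane => (inner ℝ u p, inner ℝ v p)) '' S =
      (MeasurableEquiv.finTwoArrow (α := ℝ)) '' (Matrix.toLin' M ''
        ((MeasurableEquiv.toLp 2 (Fin 2 → ℝ)).symm '' S)) := by
    rw [image_image, image_image]
    refine image_congr fun p _ => ?_
    simp [M, PiLp.inner_apply, dotProduct, MeasurableEquiv.finTwoArrow, mul_comm]
  rw [himage, measureReal_def, MeasurableEquiv.image_eq_preimage_symm,
    (volume_preserving_finTwoArrow ℝ).symm.measure_preimage_equiv,
    Measure.addHaar_image_linearMap, MeasurableEquiv.image_eq_preimage_symm,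
    (EuclideanSpace.volume_preserving_symm_measurableEquiv_toLp
      (Fin 2)).symm.measure_preimage_equiv]
  simp [M, LinearMap.det_toLin', Matrix.det_fin_two, planeDet, measureReal_def]

/-- The pair `e'`, `f'` is the dual basis of the basis `e`, `f` of the plane, with the inner
product identifying functionals with vectors. -/
structure IsDualFrame (e f e' f' : Plane) : Prop where
  ee : inner ℝ e' e = 1
  ef : inner ℝ e' f = 0
  fe : inner ℝ f' e = 0
  ff : inner ℝ f' f = 1

lemma exists_isDualFrame {e f : Plane} (h : LinearIndependent ℝ ![e, f]) :
    ∃ e' f' : Plane, IsDualFrame e f e' f' := by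
  let b := basisOfLinearIndependentOfCardEqFinrank h (by simp)
  let dual (i : Fin 2) : Plane :=
    (InnerProductSpace.toDual ℝ Plane).symm (LinearMap.toContinuousLinearMap (b.coord i))
  have hdual (i j : Fin 2) : inner ℝ (dual i) (![e, f] j) = if j = i then 1 else 0 := by
    rw [InnerProductSpace.toDual_symm_apply, LinearMap.coe_toContinuousLinearMap',
      ← b.repr_self_apply, ← coe_basisOfLinearIndependentOfCardEqFinrank h (by simp)]
    rfl
  exact ⟨dual 0, dual 1, hdual 0 0, hdual 0 1, hdual 1 0, hdual 1 1⟩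

/-- The trapezoid with corner `a` cut out by the coordinate functionals `e'`, `f'`: its two sides
parallel to the kernel of `f'` have lengths in the ratio `1 : 1 - k`. -/
def frameTrapezoid (a e' f' : Plane) (k : ℝ) : Set Plane :=
  {q | 0 ≤ inner ℝ f' (q - a) ∧ inner ℝ f' (q - a) ≤ 1 ∧ 0 ≤ inner ℝ e' (q - a) ∧
    inner ℝ e' (q - a) + k * inner ℝ f' (q - a) ≤ 1}

lemma convex_frameTrapezoid (a e' f' : Plane) (k : ℝ) :
    Convex ℝ (frameTrapezoid a e' f' k) := by
  rintro x ⟨hxf0, hxf1, hxe0, hxe1⟩ y ⟨hyf0, hyf1, hye0, hye1⟩ s t hs ht hst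
  have hsub : s • x + t • y - a = s • (x - a) + t • (y - a) := by
    rw [smul_sub, smul_sub, sub_add_sub_comm, ← add_smul, hst, one_smul]
  simp only [frameTrapezoid, mem_ofPred_eq, hsub, inner_add_right, inner_smul_right]
  refine ⟨by positivity, ?_, by positivity, ?_⟩
  · linarith [mul_le_mul_of_nonneg_left hxf1 hs, mul_le_mul_of_nonneg_left hyf1 ht]
  · linarith [mul_le_mul_of_nonneg_left hxe1 hs, mul_le_mul_of_nonneg_left hye1 ht]

namespace IsDualFrame

variable {a e f e' f' : Plane} {k : ℝ}

lemma symm (h : IsDualFrame e f e' f') : IsDualFrame e' f' e f :=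
  ⟨(real_inner_comm ..).trans h.ee, (real_inner_comm ..).trans h.fe,
    (real_inner_comm ..).trans h.ef, (real_inner_comm ..).trans h.ff⟩

lemma abs_planeDet_mul_abs_planeDet (h : IsDualFrame e f e' f') :
    |planeDet f' e'| * |planeDet e f| = 1 := by
  obtain ⟨ee, ef, fe, ff⟩ := h
  simp only [PiLp.inner_apply, Fin.sum_univ_two, RCLike.inner_apply, conj_trivial] at ee ef fe ff
  rw [← abs_mul, abs_eq zero_le_one]
  right
  rw [planeDet, planeDet]
  linear_combination -(f 0 * f' 0 + f 1 * f' 1) * ee + (f 0 * e' 0 + f 1 * e' 1) * fe - ff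

lemma eq_inner_smul_add (h : IsDualFrame e f e' f') (x : Plane) :
    x = inner ℝ e' x • e + inner ℝ f' x • f := by
  obtain ⟨ee, ef, fe, ff⟩ := h
  simp only [PiLp.inner_apply, Fin.sum_univ_two, RCLike.inner_apply, conj_trivial] at ee ef fe ff
  have hmul : !![e' 0, e' 1; f' 0, f' 1] * !![e 0, f 0; e 1, f 1] = 1 := by
    ext i j
    fin_cases i <;> fin_cases j <;>
      simp only [Fin.zero_eta, Fin.mk_one, Matrix.mul_apply, Fin.sum_univ_two, Matrix.of_apply,
        Matrix.cons_val, Matrix.one_fin_two] <;>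
      linarith
  have hentry := Matrix.ext_iff.2 (mul_eq_one_comm.1 hmul)
  simp only [Matrix.mul_apply, Fin.sum_univ_two, Matrix.one_fin_two] at hentry
  ext i
  have h0 := hentry i 0
  have h1 := hentry i 1
  fin_cases i <;>
    simp only [Fin.zero_eta, Fin.mk_one, Matrix.of_apply, Matrix.cons_val, PiLp.inner_apply,
      RCLike.inner_apply, conj_trivial, Fin.sum_univ_two, PiLp.add_apply, PiLp.smul_apply,
      smul_eq_mul] at h0 h1 ⊢ <;>
    linear_combination -(x 0 * h0 + x 1 * h1)

lemma convexHull_eq_frameTrapezoid (h : IsDualFrame e f e' f') (hk1 : k ≤ 1) :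
    convexHull ℝ {a, a + e, a + f + (1 - k) • e, a + f} = frameTrapezoid a e' f' k := by
  apply Subset.antisymm
  · refine convexHull_min ?_ (convex_frameTrapezoid a e' f' k)
    rintro q (rfl | rfl | rfl | rfl) <;>
      simp [frameTrapezoid, h.ee, h.ef, h.fe, h.ff, inner_add_right, inner_smul_right, add_assoc,
        hk1]
  · rintro q ⟨hf0, hf1, he0, he1⟩
    have hq := h.eq_inner_smul_add (q - a)
    set s := inner ℝ e' (q - a)
    set t := inner ℝ f' (q - a)
    have hconv := convex_convexHull ℝ ({a, a + e, a + f + (1 - k) • e, a + f} : Set Plane)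
    have hsub := subset_convexHull ℝ ({a, a + e, a + f + (1 - k) • e, a + f} : Set Plane)
    have hleft := hconv.add_smul_sub_mem (hsub (by simp : a ∈ _)) (hsub (by simp : a + f ∈ _))
      (t := t) ⟨hf0, hf1⟩
    have hright := hconv.add_smul_sub_mem (hsub (by simp : a + e ∈ _))
      (hsub (by simp : a + f + (1 - k) • e ∈ _)) (t := t) ⟨hf0, hf1⟩
    have hmem := hconv.add_smul_sub_mem hleft hright (t := s / (1 - k * t))
      ⟨div_nonneg he0 (by linarith), div_le_one_of_le₀ (by linarith) (by linarith)⟩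
    have hst : s / (1 - k * t) * (1 - k * t) = s := by
      rcases eq_or_ne (1 - k * t) 0 with h0 | h0
      · rw [h0, mul_zero]; linarith
      · exact div_mul_cancel₀ _ h0
    convert hmem using 1
    rw [← sub_add_cancel q a, hq]
    nth_rewrite 1 [← hst]
    module

lemma isCompact_frameTrapezoid (h : IsDualFrame e f e' f') (hk1 : k ≤ 1) :
    IsCompact (frameTrapezoid a e' f' k) := by
  rw [← h.convexHull_eq_frameTrapezoid hk1]
  exact (toFinite _).isCompact_convexHull ℝ

end IsDualFrame

lemma linearIndependent_sub_of_affineIndependent {K V : Type*} [Ring K] [AddCommGroup V]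
    [Module K V] {a b c : V} (h : AffineIndependent K ![a, b, c]) :
    LinearIndependent K ![b - a, c - a] := by
  rw [affineIndependent_iff_linearIndependent_vsub K _ (0 : Fin 3),
    ← linearIndependent_equiv (finSuccAboveEquiv (0 : Fin 3))] at h
  convert! h using 1
  ext i
  fin_cases i <;> rfl

namespace IsTrapezoid

variable {Q : Set Plane}

open Pointwise in
lemma image_sub (hQ : IsTrapezoid Q) (q₀ : Plane) : IsTrapezoid ((fun q => q - q₀) '' Q) := by
  obtain ⟨a, b, c, d, hind, ⟨r, hr, hcd⟩, rfl⟩ := hQ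
  have himage (S : Set Plane) : (fun q => q - q₀) '' S = -q₀ +ᵥ S := by
    simp only [sub_eq_neg_add]
    rfl
  refine ⟨a - q₀, b - q₀, c - q₀, d - q₀, ?_, ⟨r, hr, by simpa using hcd⟩, ?_⟩
  · convert! hind.vadd (v := -q₀) using 1
    ext1 i
    fin_cases i <;> simp [sub_eq_neg_add]
  · rw [himage, ← convexHull_vadd, ← himage]
    simp only [image_insert_eq, image_singleton]

lemma exists_linearIndependent (hQ : IsTrapezoid Q) :
    ∃ (a e f : Plane) (k : ℝ), 0 ≤ k ∧ k ≤ 1 ∧ LinearIndependent ℝ ![e, f] ∧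
      Q = convexHull ℝ {a, a + e, a + f + (1 - k) • e, a + f} := by
  obtain ⟨a, b, c, d, hind, ⟨r, hr, hcd⟩, rfl⟩ := hQ
  have hlin := linearIndependent_sub_of_affineIndependent hind
  rcases le_or_gt r 1 with hr1 | hr1
  · refine ⟨a, b - a, d - a, 1 - r, by linarith, by linarith, hlin, ?_⟩
    rw [sub_sub_cancel, ← hcd, add_sub_cancel, add_sub_cancel, add_sub_cancel]
  · have hr0 : r ≠ 0 := by linarith
    refine ⟨d, c - d, a - d, 1 - r⁻¹, by linarith [inv_le_one_of_one_le₀ hr1.le],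
      by linarith [inv_nonneg.2 hr], ?_, ?_⟩
    · rw [hcd, ← neg_sub d a, LinearIndependent.pair_neg_right_iff]
      simpa using (LinearIndependent.pair_smul_smul_iff (IsUnit.mk0 r hr0) isUnit_one).2 hlin
    · rw [sub_sub_cancel, hcd, inv_smul_smul₀ hr0, ← hcd, add_sub_cancel, add_sub_cancel,
        add_sub_cancel]
      congr 1
      ext y
      simp only [mem_insert_iff, mem_singleton_iff]
      tauto

lemma exists_frame (hQ : IsTrapezoid Q) :
    ∃ (a e f e' f' : Plane) (k : ℝ), 0 ≤ k ∧ k ≤ 1 ∧ IsDualFrame e f e' f' ∧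
      Q = frameTrapezoid a e' f' k := by
  obtain ⟨a, e, f, k, hk, hk1, hlin, rfl⟩ := hQ.exists_linearIndependent
  obtain ⟨e', f', h⟩ := exists_isDualFrame hlin
  exact ⟨a, e, f, e', f', k, hk, hk1, h, h.convexHull_eq_frameTrapezoid hk1⟩

end IsTrapezoid

/-! ### The capacity of the product -/

/-- The three closed triples of outer normals of the sides of `frameTrapezoid a e' f' k` that detect
whether a curve has a translate in the trapezoid: the two parallel sides, and the two cyclic orders
of the three sides cutting out a triangle. The normals in a triple are scaled so that a triple of
points of the trapezoid, one on each of the sides, has total support `1`. -/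
noncomputable def frameNormals (e' f' : Plane) (k : ℝ) : Fin 3 → Fin 3 → Plane :=
  ![![f', -f', 0], ![e' + k • f', -e', -(k • f')], ![e' + k • f', -(k • f'), -e']]

section Frame

variable {T : Set Plane} {a e f e' f' : Plane} {c k : ℝ}

lemma sum_frameNormals (e' f' : Plane) (k : ℝ) (i : Fin 3) : ∑ j, frameNormals e' f' k i j = 0 := by
  fin_cases i <;> simp [Fin.sum_univ_three, frameNormals]

lemma IsDualFrame.frameNormals_ne_zero (h : IsDualFrame e f e' f') (i : Fin 3) :
    frameNormals e' f' k i ≠ 0 := by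
  have hside : inner ℝ (frameNormals e' f' k i 0) (![f, e, e] i) = 1 := by
    fin_cases i <;>
      simp [frameNormals, inner_add_left, real_inner_smul_left, h.ff, h.ee, h.fe]
  intro h0
  simp [h0] at hside

lemma inner_frameNormals_le (hk : 0 ≤ k) {y : Plane} (hy : y ∈ frameTrapezoid a e' f' k)
    (i j : Fin 3) :
    inner ℝ (frameNormals e' f' k i j) (y - a) ≤ (Pi.single 0 1 : Fin 3 → ℝ) j := by
  obtain ⟨hf0, hf1, he0, he1⟩ := hy
  fin_cases i <;> fin_cases j <;>
    simp [frameNormals, inner_add_left, real_inner_smul_left, hf0, hf1, he0, he1,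
      mul_nonneg hk hf0]

namespace BoundsInscribed

variable {ι : Type*} [LinearOrder ι] {q : ι → Plane} {A : ℝ}

lemma mul_height_le (h : BoundsInscribed 3 T q A)
    (hT : ∀ i, HasPolygon T c (frameNormals e' f' k i)) (l j : ι) :
    c * (inner ℝ f' (q l) - inner ℝ f' (q j)) ≤ A := by
  obtain ⟨r, hr⟩ := (or_self_iff ..).1 (exists_monotone_rotation l j j)
  have hle := h.mul_sum_le (hT 0) hr
  simpa [Fin.sum_univ_three, frameNormals, sub_eq_add_neg] using hle

lemma mul_width_le (h : BoundsInscribed 3 T q A)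
    (hT : ∀ i, HasPolygon T c (frameNormals e' f' k i)) (l i j : ι) :
    c * (inner ℝ e' (q l) - inner ℝ e' (q i) + k * (inner ℝ f' (q l) - inner ℝ f' (q j))) ≤ A := by
  rcases exists_monotone_rotation l i j with ⟨r, hr⟩ | ⟨r, hr⟩
  · have hle := h.mul_sum_le (hT 1) hr
    simp only [Fin.sum_univ_three, frameNormals, Matrix.cons_val, inner_add_left, inner_neg_left,
      real_inner_smul_left] at hle
    linarith
  · have hle := h.mul_sum_le (hT 2) hr
    simp only [Fin.sum_univ_three, frameNormals, Matrix.cons_val, inner_add_left, inner_neg_left,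
      real_inner_smul_left] at hle
    linarith

lemma exists_translate (h : BoundsInscribed 3 T q A) (hA : 0 < A) (hc : 0 < c)
    (hfr : IsDualFrame e f e' f') (hT : ∀ i, HasPolygon T c (frameNormals e' f' k i))
    (hmin : ∀ u, ∃ i, ∀ l, inner ℝ u (q i) ≤ inner ℝ u (q l)) :
    ∃ v : Plane, ∀ l, ∃ y ∈ frameTrapezoid a e' f' k, q l + v = (A / c) • y := by
  obtain ⟨i, hi⟩ := hmin e'
  obtain ⟨j, hj⟩ := hmin f'
  have hAc : 0 < A / c := div_pos hA hc
  set corner : Plane := inner ℝ e' (q i) • e + inner ℝ f' (q j) • f with hcorner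
  have hcorner_e (l : ι) : inner ℝ e' (q l - corner) = inner ℝ e' (q l) - inner ℝ e' (q i) := by
    simp [hcorner, inner_sub_right, inner_add_right, inner_smul_right, hfr.ee, hfr.ef]
  have hcorner_f (l : ι) : inner ℝ f' (q l - corner) = inner ℝ f' (q l) - inner ℝ f' (q j) := by
    simp [hcorner, inner_sub_right, inner_add_right, inner_smul_right, hfr.fe, hfr.ff]
  refine ⟨(A / c) • a - corner, fun l => ⟨a + (A / c)⁻¹ • (q l - corner), ?_, ?_⟩⟩
  · have hheight := h.mul_height_le hT l j
    have hwidth := h.mul_width_le hT l i j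
    rw [mul_comm, ← le_div_iff₀ hc] at hheight hwidth
    simp only [frameTrapezoid, mem_ofPred_eq, add_sub_cancel_left, inner_smul_right,
      hcorner_e, hcorner_f]
    refine ⟨mul_nonneg (inv_nonneg.2 hAc.le) (sub_nonneg.2 (hj l)),
      (inv_mul_le_one₀ hAc).2 hheight, mul_nonneg (inv_nonneg.2 hAc.le) (sub_nonneg.2 (hi l)), ?_⟩
    rwa [mul_left_comm, ← mul_add, inv_mul_le_one₀ hAc]
  · rw [smul_add, smul_inv_smul₀ hAc.ne']
    abel

end BoundsInscribed

lemma IsClosedCharacteristic.le_loopAction (hc : 0 < c) (hT : IsConvexBody T)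
    (hT0 : T ∈ nhds (0 : Plane)) (hk1 : k ≤ 1) (hA0 : frameTrapezoid a e' f' k ∈ nhds (0 : Plane))
    (hfr : IsDualFrame e f e' f') (hpoly : ∀ i, HasPolygon T c (frameNormals e' f' k i))
    {x : ℝ → PhaseSpace} (hx : IsClosedCharacteristic (frameTrapezoid a e' f' k ×ˢ T) x) :
    c ≤ loopAction x := by
  have hbilliard := hx.isBilliardTrajectory (hfr.isCompact_frameTrapezoid hk1).isClosed
    hT.isCompact.isClosed hA0 hT0 (convex_frameTrapezoid a e' f' k) hT.convex
  have haction := hx.loopAction_eq_integral hbilliard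
  have hpos := hx.loopAction_pos
  have hcont := hbilliard.absolutelyContinuous_fst.continuousOn
  rw [uIcc_of_le zero_le_one] at hcont
  have hmin (u : Plane) : ∃ i : Icc (0 : ℝ) 1, ∀ l : Icc (0 : ℝ) 1,
      inner ℝ u (x i).1 ≤ inner ℝ u (x l).1 := by
    obtain ⟨i, hi, hmin⟩ := isCompact_Icc.exists_isMinOn (nonempty_Icc.2 zero_le_one)
      (f := fun t => inner ℝ u (x t).1) (continuousOn_const.inner hcont)
    exact ⟨⟨i, hi⟩, fun l => hmin l.2⟩
  have hbound := hbilliard.boundsInscribed 3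
  rw [← haction] at hbound
  obtain ⟨v, hv⟩ := hbound.exists_translate (a := a) hpos hc hfr hpoly hmin
  rw [← one_le_div hc]
  exact hbilliard.one_le_of_translate_mem_smul (haction ▸ hpos) (div_pos hpos hc).le
    fun t ht => hv ⟨t, ht⟩

/-- The equality `∑ ⟪d j, q j⟫ = 1` forces every vertex of the translated dual polygon onto the
side of the trapezoid with normal `d j`. -/
lemma IsDualPolygon.inner_frameNormals_eq {p q : Fin 3 → Plane} {i : Fin 3} (hk : 0 ≤ k)
    (h : IsDualPolygon T c (frameNormals e' f' k i) p q)
    {v : Plane} (hv : ∀ j, q j + v ∈ frameTrapezoid a e' f' k) (j : Fin 3) :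
    inner ℝ (frameNormals e' f' k i j) (q j + v - a) = (Pi.single 0 1 : Fin 3 → ℝ) j := by
  have hle : ∀ j ∈ Finset.univ, inner ℝ (frameNormals e' f' k i j) (q j + v - a) ≤
      (Pi.single 0 1 : Fin 3 → ℝ) j := fun j _ => inner_frameNormals_le hk (hv j) i j
  refine (Finset.sum_eq_sum_iff_of_le hle).1 ?_ j (Finset.mem_univ j)
  simp only [add_sub_assoc, inner_add_right, Finset.sum_add_distrib]
  rw [← _root_.sum_inner, sum_frameNormals, h.sum_inner, inner_zero_left, add_zero,
    Fintype.sum_pi_single']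

lemma IsDualPolygon.mem_actionSpectrum {p q : Fin 3 → Plane} {i : Fin 3} (hc : 0 < c)
    (hT : IsConvexBody T) (hT0 : T ∈ nhds (0 : Plane)) (hk : 0 ≤ k)
    (hA0 : frameTrapezoid a e' f' k ∈ nhds (0 : Plane)) (hfr : IsDualFrame e f e' f')
    (hpoly : ∀ i, HasPolygon T c (frameNormals e' f' k i))
    (h : IsDualPolygon T c (frameNormals e' f' k i) p q) :
    c ∈ actionSpectrum (frameTrapezoid a e' f' k ×ˢ T) := by
  obtain ⟨v, hv⟩ := (h.boundsInscribed (n := 3)).exists_translate (a := a) hc hc hfr hpoly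
    fun u => Finite.exists_min fun j => inner ℝ u (q j)
  have hmem (j : Fin 3) : q j + v ∈ frameTrapezoid a e' f' k := by
    obtain ⟨y, hy, heq⟩ := hv j
    rwa [heq, div_self hc.ne', one_smul]
  have hnormal (j : Fin 3) : p (j - 1) - p j ∈ normalCone (frameTrapezoid a e' f' k) (q j + v) := by
    intro y hy
    have hle := inner_frameNormals_le hk hy i j
    rw [← h.inner_frameNormals_eq hk hmem j, inner_sub_right, inner_sub_right,
      sub_le_sub_iff_right] at hle
    rw [h.edge, real_inner_smul_left, real_inner_smul_left]
    exact mul_le_mul_of_nonneg_left hle hc.le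
  have hlength : ∑ j, inner ℝ (q (j + 1) + v - (q j + v)) (p j) = c := by
    simpa only [add_sub_add_right_eq_sub] using h.sum_inner_edges
  have hmem_spectrum := mem_actionSpectrum_of_polygons hA0 hT0 (convex_frameTrapezoid a e' f' k)
    hT.convex hmem h.mem (fun j => by simpa only [add_sub_add_right_eq_sub] using h.normal j)
    hnormal (by rwa [hlength])
  rwa [hlength] at hmem_spectrum

lemma exists_isLeast_actionSpectrum (hT : IsConvexBody T) (hT0 : T ∈ nhds (0 : Plane))
    (hk : 0 ≤ k) (hk1 : k ≤ 1) (hA0 : frameTrapezoid a e' f' k ∈ nhds (0 : Plane))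
    (hfr : IsDualFrame e f e' f') :
    ∃ c, 0 < c ∧ (∀ i, HasPolygon T c (frameNormals e' f' k i)) ∧
      IsLeast (actionSpectrum (frameTrapezoid a e' f' k ×ˢ T)) c := by
  choose s hs p q hpq using fun i => exists_isDualPolygon hT.isCompact hT.convex
    hT.interior_nonempty (sum_frameNormals e' f' k i) (hfr.frameNormals_ne_zero i)
  obtain ⟨i, hi⟩ := Finite.exists_min s
  have hpoly (j : Fin 3) : HasPolygon T (s i) (frameNormals e' f' k j) :=
    (hpq j).hasPolygon.mono hT.convex (hs i) (hi j)
  refine ⟨s i, hs i, hpoly, (hpq i).mem_actionSpectrum (hs i) hT hT0 hk hA0 hfr hpoly, ?_⟩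
  rintro _ ⟨x, hx, rfl⟩
  exact hx.le_loopAction (hs i) hT hT0 hk1 hA0 hfr hpoly

/-! ### The volume of the product -/

lemma convex_image_inner_prod (u v : Plane) {S : Set Plane} (hS : Convex ℝ S) :
    Convex ℝ ((fun p : Plane => (inner ℝ u p, inner ℝ v p)) '' S) :=
  hS.is_linear_image
    ⟨fun x y => by simp [inner_add_right], fun r x => by simp [inner_smul_right]⟩

lemma isCompact_image_inner_prod (u v : Plane) {S : Set Plane} (hS : IsCompact S) :
    IsCompact ((fun p : Plane => (inner ℝ u p, inner ℝ v p)) '' S) :=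
  hS.image (by fun_prop)

lemma hasChord_image_inner_prod {u v x y : Plane} {S : Set Plane} {l : ℝ} (hx : x ∈ S)
    (hy : y ∈ S) (hu : inner ℝ u (y - x) = 0) (hv : inner ℝ v (y - x) = l) :
    HasChord ((fun p : Plane => (inner ℝ u p, inner ℝ v p)) '' S) (inner ℝ u x) l := by
  rw [inner_sub_right] at hu hv
  exact ⟨inner ℝ v x, ⟨x, hx, rfl⟩, ⟨y, hy, by ext <;> dsimp only <;> linarith⟩⟩

lemma IsDualFrame.half_le_volume_frameTrapezoid (hfr : IsDualFrame e f e' f') (hk1 : k ≤ 1) :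
    (2 - k) / 2 ≤ |planeDet f' e'| * volume.real (frameTrapezoid a e' f' k) := by
  rw [← volume_real_image_inner_prod]
  have hcorner₀ : a ∈ frameTrapezoid a e' f' k := by simp [frameTrapezoid]
  have hcorner₁ : a + e ∈ frameTrapezoid a e' f' k := by simp [frameTrapezoid, hfr.ee, hfr.fe]
  have hcorner₂ : a + f ∈ frameTrapezoid a e' f' k := by
    simp [frameTrapezoid, hfr.ef, hfr.ff, hk1]
  have hcorner₃ : a + f + (1 - k) • e ∈ frameTrapezoid a e' f' k := by
    simp [frameTrapezoid, add_assoc, inner_add_right, inner_smul_right, hfr.ee, hfr.ef, hfr.fe,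
      hfr.ff, hk1]
  have hlong := hasChord_image_inner_prod (u := f') (v := e') (l := 1) hcorner₀ hcorner₁
    (by simp [hfr.fe]) (by simp [hfr.ee])
  have hshort := hasChord_image_inner_prod (u := f') (v := e') (l := 1 - k) hcorner₂ hcorner₃
    (by simp [inner_smul_right, hfr.fe]) (by simp [inner_smul_right, hfr.ee])
  rw [inner_add_right, hfr.ff] at hshort
  refine le_of_eq_of_le ?_ (sum_trapezoids_le_volume
    (convex_image_inner_prod f' e' (convex_frameTrapezoid a e' f' k))
    (isCompact_image_inner_prod f' e' (hfr.isCompact_frameTrapezoid hk1))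
    (x := ![inner ℝ f' a, inner ℝ f' a + 1]) (l := ![1, 1 - k]) ?_ ?_ ?_)
  · simp only [Fin.sum_univ_one, Fin.castSucc_zero, Matrix.cons_val_zero, Matrix.cons_val_succ]
    ring
  · simp [Fin.monotone_iff_le_succ]
  · simp [Fin.forall_fin_succ, hk1]
  · simp [Fin.forall_fin_succ, hlong, hshort]

lemma IsDualFrame.sq_div_le_volume (hfr : IsDualFrame e f e' f') (hc : 0 ≤ c) (hk : 0 ≤ k)
    (hk1 : k ≤ 1) (hT : IsConvexBody T) (hpoly : ∀ i, HasPolygon T c (frameNormals e' f' k i)) :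
    c ^ 2 / (2 - k) ≤ |planeDet e f| * volume.real T := by
  rw [← volume_real_image_inner_prod]
  have hdual := hfr.symm
  obtain ⟨u, hu, hud⟩ := hpoly 0
  obtain ⟨v, hv, hvd⟩ := hpoly 1
  obtain ⟨w, hw, hwd⟩ := hpoly 2
  have hu₂ : u 2 - u 0 = c • f' := hud 0
  have hv₁ : v 1 - v 0 = c • e' := by
    rw [← neg_sub, show v 0 - v 1 = c • -e' from hvd 1, smul_neg, neg_neg]
  have hv₂ : v 2 - v 1 = (c * k) • f' := by
    rw [← neg_sub, show v 1 - v 2 = c • -(k • f') from hvd 2, smul_neg, neg_neg, mul_smul]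
  have hw₁ : w 1 - w 0 = (c * k) • f' := by
    rw [← neg_sub, show w 0 - w 1 = c • -(k • f') from hwd 1, smul_neg, neg_neg, mul_smul]
  have hw₂ : w 2 - w 0 = c • e' + (c * k) • f' := by
    rw [← sub_add_sub_cancel _ (w 1), hw₁, ← neg_sub (w 1), show w 1 - w 2 = c • -e' from hwd 2,
      smul_neg, neg_neg]
  have hαc : inner ℝ e (w 2) = inner ℝ e (w 0) + c := by
    rw [← sub_eq_iff_eq_add', ← inner_sub_right, hw₂]
    simp [inner_add_right, inner_smul_right, hdual.ee, hdual.ef]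
  have hβc : inner ℝ e (v 1) = inner ℝ e (v 0) + c := by
    rw [← sub_eq_iff_eq_add', ← inner_sub_right, hv₁]
    simp [inner_smul_right, hdual.ee]
  refine sq_div_le_volume_of_chords (convex_image_inner_prod e f hT.convex)
    (isCompact_image_inner_prod e f hT.isCompact) hc hk hk1
    (hasChord_image_inner_prod (hw 0) (hw 1) ?_ ?_)
    (hαc ▸ hasChord_image_inner_prod (hw 2) (hw 2) ?_ ?_)
    (hasChord_image_inner_prod (hv 0) (hv 0) ?_ ?_)
    (hβc ▸ hasChord_image_inner_prod (hv 1) (hv 2) ?_ ?_)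
    (hasChord_image_inner_prod (hu 0) (hu 2) ?_ ?_)
  all_goals simp [hw₁, hv₂, hu₂, inner_smul_right, hdual.ef, hdual.ff]

lemma IsDualFrame.sq_half_le_volume_prod (hfr : IsDualFrame e f e' f') (hc : 0 ≤ c) (hk : 0 ≤ k)
    (hk1 : k ≤ 1) (hT : IsConvexBody T) (hpoly : ∀ i, HasPolygon T c (frameNormals e' f' k i)) :
    c ^ 2 / 2 ≤ volume.real (frameTrapezoid a e' f' k ×ˢ T) := by
  have h2k : 0 < 2 - k := by linarith
  calc c ^ 2 / 2 = (2 - k) / 2 * (c ^ 2 / (2 - k)) := by field_simp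
    _ ≤ (|planeDet f' e'| * volume.real (frameTrapezoid a e' f' k)) *
        (|planeDet e f| * volume.real T) :=
      mul_le_mul (hfr.half_le_volume_frameTrapezoid hk1) (hfr.sq_div_le_volume hc hk hk1 hT hpoly)
        (by positivity) (by positivity)
    _ = volume.real (frameTrapezoid a e' f' k ×ˢ T) := by
      rw [mul_mul_mul_comm, hfr.abs_planeDet_mul_abs_planeDet, one_mul, Measure.volume_eq_prod,
        measureReal_prod_prod]

end Frame

lemma isLeast_cEHZ_and_sq_half_le_volume {Q T : Set Plane} (hQ : IsTrapezoid Q)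
    (hT : IsConvexBody T) (hQ0 : Q ∈ nhds (0 : Plane)) (hT0 : T ∈ nhds (0 : Plane)) :
    IsLeast (actionSpectrum (Q ×ˢ T)) (cEHZ (Q ×ˢ T)) ∧
      cEHZ (Q ×ˢ T) ^ 2 / 2 ≤ volume.real (Q ×ˢ T) := by
  obtain ⟨a, e, f, e', f', k, hk, hk1, hfr, rfl⟩ := hQ.exists_frame
  obtain ⟨c, hc, hpoly, hleast⟩ := exists_isLeast_actionSpectrum hT hT0 hk hk1 hQ0 hfr
  rw [cEHZ, hleast.csInf_eq]
  exact ⟨hleast, hfr.sq_half_le_volume_prod hc.le hk hk1 hT hpoly⟩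

lemma image_sub_mem_nhds_zero {G : Type*} [AddGroup G] [TopologicalSpace G]
    [IsTopologicalAddGroup G] {S : Set G} {p : G} (hp : p ∈ interior S) :
    (fun q => q - p) '' S ∈ nhds 0 := by
  simpa using
    (Homeomorph.subRight p).isOpenMap.image_mem_nhds (mem_interior_iff_mem_nhds.1 hp)

lemma IsConvexBody.image_sub {T : Set Plane} (hT : IsConvexBody T) (p : Plane) :
    IsConvexBody ((fun q => q - p) '' T) where
  isCompact := hT.isCompact.image (by fun_prop)
  convex := by simpa [sub_eq_neg_add] using hT.convex.translate (-p)
  interior_nonempty := by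
    rw [← Homeomorph.coe_subRight, ← Homeomorph.image_interior]
    exact hT.interior_nonempty.image _

/-- For every trapezoid `Q` and every convex body `T` in the plane, `vol (Q × T)` is at least half
the square of the EHZ-capacity of `Q × T`. The capacity is computed after a translation that moves
an interior point `z₀` of `Q × T` to the origin (for `z₀ = 0` this is no translation at all). -/
theorem theorem1p1 (Q T : Set Plane) (hQ : IsTrapezoid Q) (hT : IsConvexBody T)
    (z₀ : PhaseSpace) (hz₀ : z₀ ∈ interior (Q ×ˢ T)) :
    IsLeast (actionSpectrum ((fun z => z - z₀) '' (Q ×ˢ T)))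
        (cEHZ ((fun z => z - z₀) '' (Q ×ˢ T))) ∧
      (volume : Measure PhaseSpace).real (Q ×ˢ T) ≥
        cEHZ ((fun z => z - z₀) '' (Q ×ˢ T)) ^ 2 / 2 := by
  obtain ⟨q₀, p₀⟩ := z₀
  rw [interior_prod_eq] at hz₀
  have himage : (fun z : PhaseSpace => z - (q₀, p₀)) '' (Q ×ˢ T) =
      ((fun q => q - q₀) '' Q) ×ˢ ((fun p => p - p₀) '' T) :=
    prodMap_image_prod (fun q => q - q₀) (fun p => p - p₀) Q T
  have hvolume : volume.real ((fun z : PhaseSpace => z - (q₀, p₀)) '' (Q ×ˢ T)) =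
      volume.real (Q ×ˢ T) := by
    simp only [sub_eq_add_neg, image_add_right, measureReal_def, Measure.volume_eq_prod]
    rw [measure_preimage_add_right]
  rw [← hvolume, himage]
  exact isLeast_cEHZ_and_sq_half_le_volume (hQ.image_sub q₀) (hT.image_sub p₀)
    (image_sub_mem_nhds_zero hz₀.1) (image_sub_mem_nhds_zero hz₀.2)
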